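/- Let $V$ be an $n$-dimensional complex inner product space and let $W\subseteq U(V)$ be a finite unitary reflection group (a finite group generated by unitary reflections, i.e. unitary transformations whose fixed space is a hyperplane) acting irreducibly on $V$. Let $x_1,\dots,x_n$ be an orthonormal basis of $V^*$, let $S=S(V^*)=\mathbb C[x_1,\dots,x_n]$ with the action $(w\cdot f)(v)=f(w^{-1}v)$, let $S_k\subseteq S$ be the space of homogeneous polynomials of degree $k$ (together with $0$), $R=S^W$ and $R_k=R\cap S_k$. For $f=\sum_a c_a x^a\in S$ let $f^*=\sum_a\overline{c_a}\,\partial^a$ be the associated constant-coefficient differential operator. For each reflecting hyperplane $H$ of $W$ choose $L_H\in V^*$ with $\ker L_H=H$, let $e_H$ be the order of the cyclic group of elements of $W$ fixing $H$ pointwise, and put $\Delta=\prod_H L_H^{e_H-1}$ and $\mathcal H=\{f^*\Delta\mid f\in S\}$. Let $d:S\to S\otimes V^*$, $dh=\sum_j\partial_jh\otimes x_j$, and $\varepsilon:S\otimes V^*\to S$, $\varepsilon(\sum_j h_j\otimes x_j)=\sum_j x_jh_j$; the group $W$ acts diagonally on $S\otimes V^*$. Let $f_1,\dots,f_n$ be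 a canonical system for $W$, that is, $f_1,\dots,f_n$ are algebraically independent homogeneous polynomials that generate the algebra $R$ and satisfy $f_i^*f_j=\delta_{ij}$ for all $i,j$. Let $\mathcal F=\langle f_1,\dots,f_n\rangle_{\mathbb C}$. Then (1) $\displaystyle \mathcal F=\bigoplus_{k=1}^{\infty}\{f\in R_k\mid g^*f=0\text{ for all }g\in R_\ell\text{ with }0<\ell<k\}$; (2) $\langle df_1,\dots,df_n\rangle_{\mathbb C}=(\mathcal H\otimes_{\mathbb C}V^*)^W$; (3) $\mathcal F=\varepsilon\bigl((\mathcal H\otimes_{\mathbb C}V^*)^W\bigr)$. -/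

import Mathlib

open MvPolynomial TensorProduct

noncomputable section

namespace UnitaryReflection

section General

variable {V : Type*} [NormedAddCommGroup V] [InnerProductSpace ℂ V]

/-- The subspace of vectors fixed by the unitary transformation `w`. -/
def fixedSpace (w : V ≃ₗᵢ[ℂ] V) : Submodule ℂ V where
  carrier := {v | w v = v}
  add_mem' := by
    intro u v hu hv
    simp only [Set.mem_ofPred_eq] at *
    rw [map_add, hu, hv]
  zero_mem' := by simp
  smul_mem' := by
    intro c v hv
    simp only [Set.mem_ofPred_eq] at *
    rw [map_smul, hv]

/-- A (unitary) reflection: a unitary transformation whose fixed space is a hyperplane. (Reflections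
are also required to have finite order, which is automatic for elements of a finite group.) -/
def IsReflection (w : V ≃ₗᵢ[ℂ] V) : Prop :=
  Module.finrank ℂ (fixedSpace w) + 1 = Module.finrank ℂ V

/-- `W` is a finite unitary reflection group: a finite subgroup of `U(V)` generated by
reflections. -/
structure IsFiniteReflectionGroup (W : Subgroup (V ≃ₗᵢ[ℂ] V)) : Prop where
  finite : Finite W
  generated : Subgroup.closure {w | w ∈ W ∧ IsReflection w} = W

/-- The tautological representation of `W ⊆ U(V)` on `V`. -/
def tautologicalRep (W : Subgroup (V ≃ₗᵢ[ℂ] V)) : Representation ℂ W V where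
  toFun w := (w : V ≃ₗᵢ[ℂ] V).toLinearEquiv.toLinearMap
  map_one' := rfl
  map_mul' _ _ := rfl

/-- The set of reflecting hyperplanes of `W`. -/
def reflectingHyperplanes (W : Subgroup (V ≃ₗᵢ[ℂ] V)) : Set (Submodule ℂ V) :=
  {H | ∃ s ∈ W, IsReflection s ∧ fixedSpace s = H}

/-- `e_H`: the order of the (cyclic) subgroup of the elements of `W` that fix `H` pointwise; for a
reflecting hyperplane `H`, this is the cyclic group generated by the reflection `s_H`. -/
def hyperplaneOrder (W : Subgroup (V ≃ₗᵢ[ℂ] V)) (H : Submodule ℂ V) : ℕ :=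
  Nat.card {w : V ≃ₗᵢ[ℂ] V // w ∈ W ∧ ∀ v ∈ H, w v = v}

/-- The contragredient action of `U(V)` on `V^*`, `(w · L)(v) = L(w⁻¹ v)`. -/
def dualAct (w : V ≃ₗᵢ[ℂ] V) : Module.Dual ℂ V →ₗ[ℂ] Module.Dual ℂ V :=
  (w⁻¹ : V ≃ₗᵢ[ℂ] V).toLinearEquiv.toLinearMap.dualMap

end General

/-! The symmetric algebra `S = S(V^*)` is the polynomial ring `MvPolynomial (Fin n) ℂ` in the
coordinates `x_j = X j` with respect to an orthonormal basis `b` of `V`; thus `x_1, …, x_n` is an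
orthonormal basis of `V^*`. -/

section DifferentialOperators

variable {n : ℕ}

/-- The differential operator `∂^a = ∂_1^{a_1} ⋯ ∂_n^{a_n}`. -/
def partialPow (a : Fin n →₀ ℕ) : Module.End ℂ (MvPolynomial (Fin n) ℂ) :=
  ((List.finRange n).map fun i =>
    ((pderiv i).toLinearMap : Module.End ℂ (MvPolynomial (Fin n) ℂ)) ^ a i).prod

/-- The differential operator `f^* = ∑_a conj(c_a) ∂^a` attached to `f = ∑_a c_a x^a`. -/
def starOp (f : MvPolynomial (Fin n) ℂ) : Module.End ℂ (MvPolynomial (Fin n) ℂ) :=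
  ∑ a ∈ f.support, (starRingEnd ℂ) (f.coeff a) • partialPow a

theorem starOp_eq_sum_of_subset (f : MvPolynomial (Fin n) ℂ) (s : Finset (Fin n →₀ ℕ))
    (h : f.support ⊆ s) :
    starOp f = ∑ a ∈ s, (starRingEnd ℂ) (f.coeff a) • partialPow a := by
  refine Finset.sum_subset h fun a _ ha => ?_
  rw [notMem_support_iff.mp ha, map_zero, zero_smul]

theorem starOp_add (f g : MvPolynomial (Fin n) ℂ) : starOp (f + g) = starOp f + starOp g := by
  classical
  rw [starOp_eq_sum_of_subset (f + g) (f.support ∪ g.support) support_add,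
    starOp_eq_sum_of_subset f (f.support ∪ g.support) Finset.subset_union_left,
    starOp_eq_sum_of_subset g (f.support ∪ g.support) Finset.subset_union_right,
    ← Finset.sum_add_distrib]
  refine Finset.sum_congr rfl fun a _ => ?_
  rw [coeff_add, map_add, add_smul]

theorem starOp_smul (c : ℂ) (f : MvPolynomial (Fin n) ℂ) :
    starOp (c • f) = (starRingEnd ℂ) c • starOp f := by
  rw [starOp_eq_sum_of_subset (c • f) f.support support_smul, starOp, Finset.smul_sum]
  refine Finset.sum_congr rfl fun a _ => ?_
  rw [coeff_smul, smul_eq_mul, map_mul, mul_smul]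

/-- The space `{f^* P | f ∈ S}` of polynomials obtained by applying differential operators to
`P`. -/
def derivativeSpace (P : MvPolynomial (Fin n) ℂ) : Submodule ℂ (MvPolynomial (Fin n) ℂ) where
  carrier := {q | ∃ f : MvPolynomial (Fin n) ℂ, q = starOp f P}
  add_mem' := by
    rintro _ _ ⟨f, rfl⟩ ⟨g, rfl⟩
    exact ⟨f + g, by rw [starOp_add, LinearMap.add_apply]⟩
  zero_mem' := ⟨0, by simp [starOp]⟩
  smul_mem' := by
    rintro c _ ⟨f, rfl⟩
    exact ⟨(starRingEnd ℂ) c • f, by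
      rw [starOp_smul, LinearMap.smul_apply, Complex.conj_conj]⟩

end DifferentialOperators

section Invariants

variable {V : Type*} [NormedAddCommGroup V] [InnerProductSpace ℂ V] {n : ℕ}
  (b : OrthonormalBasis (Fin n) ℂ V) (W : Subgroup (V ≃ₗᵢ[ℂ] V))

/-- The inclusion `V^* → S`: the linear form `L` is the polynomial `∑_j L(b_j) x_j`. -/
def linForm : Module.Dual ℂ V →ₗ[ℂ] MvPolynomial (Fin n) ℂ :=
  ∑ j, (Module.Dual.eval ℂ V (b j)).smulRight (X j)

/-- The action `(w · f)(v) = f(w⁻¹ v)` of `U(V)` on `S`: the algebra automorphism that extends the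
action on `V^*`. -/
def polyAct (w : V ≃ₗᵢ[ℂ] V) : MvPolynomial (Fin n) ℂ →ₐ[ℂ] MvPolynomial (Fin n) ℂ :=
  aeval fun j => linForm b (dualAct w (b.toBasis.coord j))

/-- The algebra `R = S^W` of invariant polynomials. -/
def invariants : Subalgebra ℂ (MvPolynomial (Fin n) ℂ) where
  carrier := {f | ∀ w ∈ W, polyAct b w f = f}
  mul_mem' := fun hf hg w hw => by rw [map_mul, hf w hw, hg w hw]
  add_mem' := fun hf hg w hw => by rw [map_add, hf w hw, hg w hw]
  algebraMap_mem' := fun c w _ => (polyAct b w).commutes c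

/-- `R_k = R ∩ S_k`: the invariants that are homogeneous of degree `k` (or zero). -/
def homogeneousInvariants (k : ℕ) : Submodule ℂ (MvPolynomial (Fin n) ℂ) :=
  Subalgebra.toSubmodule (invariants b W) ⊓ homogeneousSubmodule (Fin n) ℂ k

/-- A system of basic invariants: `n` algebraically independent homogeneous polynomials that
generate the algebra `R`. -/
structure IsBasicInvariants (f : Fin n → MvPolynomial (Fin n) ℂ) : Prop where
  homogeneous : ∀ i, ∃ m : ℕ, (f i).IsHomogeneous m
  algebraicIndependent : AlgebraicIndependent ℂ f
  generate : Algebra.adjoin ℂ (Set.range f) = invariants b W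

/-- A canonical system: a system of basic invariants with `f_i^* f_j = δ_{ij}`. -/
structure IsCanonicalSystem (f : Fin n → MvPolynomial (Fin n) ℂ) : Prop where
  basic : IsBasicInvariants b W f
  orthonormal : ∀ i j, starOp (f i) (f j) = if i = j then 1 else 0

/-- The space of the `f ∈ R_k` such that `g^* f = 0` for all `g ∈ R_ℓ` with `0 < ℓ < k`. -/
def annihilatedInvariants (k : ℕ) : Submodule ℂ (MvPolynomial (Fin n) ℂ) where
  carrier := {f | f ∈ homogeneousInvariants b W k ∧
    ∀ l : ℕ, 0 < l → l < k → ∀ g ∈ homogeneousInvariants b W l, starOp g f = 0}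
  add_mem' := by
    rintro p q ⟨hp, hp'⟩ ⟨hq, hq'⟩
    refine ⟨add_mem hp hq, fun l h0 hl g hg => ?_⟩
    rw [map_add, hp' l h0 hl g hg, hq' l h0 hl g hg, add_zero]
  zero_mem' := ⟨zero_mem _, fun _ _ _ _ _ => map_zero _⟩
  smul_mem' := by
    rintro c p ⟨hp, hp'⟩
    refine ⟨Submodule.smul_mem _ c hp, fun l h0 hl g hg => ?_⟩
    rw [map_smul, hp' l h0 hl g hg, smul_zero]

/-- The skew-invariant `Δ = ∏_H L_H^{e_H - 1}`, the product over all reflecting hyperplanes `H`. It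
depends on a choice of linear forms `L_H` with kernel `H`. -/
def delta (L : Submodule ℂ V → Module.Dual ℂ V) : MvPolynomial (Fin n) ℂ :=
  ∏ᶠ H ∈ reflectingHyperplanes W, linForm b (L H) ^ (hyperplaneOrder W H - 1)

/-- `𝓗 = {f^* Δ | f ∈ S}`. -/
def harmonics (L : Submodule ℂ V → Module.Dual ℂ V) : Submodule ℂ (MvPolynomial (Fin n) ℂ) :=
  derivativeSpace (delta b W L)

/-- The differential `d : S → S ⊗ V^*`, `dh = ∑_j ∂_j h ⊗ x_j`. -/
def differential :
    MvPolynomial (Fin n) ℂ →ₗ[ℂ] MvPolynomial (Fin n) ℂ ⊗[ℂ] Module.Dual ℂ V :=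
  ∑ j, (TensorProduct.mk ℂ (MvPolynomial (Fin n) ℂ) (Module.Dual ℂ V)).flip (b.toBasis.coord j) ∘ₗ
    (pderiv j).toLinearMap

/-- The map `ε : S ⊗ V^* → S`, `h ⊗ L ↦ L h`. -/
def epsilon : MvPolynomial (Fin n) ℂ ⊗[ℂ] Module.Dual ℂ V →ₗ[ℂ] MvPolynomial (Fin n) ℂ :=
  TensorProduct.lift ((LinearMap.mul ℂ (MvPolynomial (Fin n) ℂ)).compl₂ (linForm b))

/-- The diagonal action of `U(V)` on `S ⊗ V^*`. -/
def formAct (w : V ≃ₗᵢ[ℂ] V) : Module.End ℂ (MvPolynomial (Fin n) ℂ ⊗[ℂ] Module.Dual ℂ V) :=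
  TensorProduct.map (polyAct b w).toLinearMap (dualAct w)

/-- `(M ⊗ V^*)^W` for a subspace `M` of `S`: the `W`-invariant elements of `S ⊗ V^*` that lie in
`M ⊗ V^*`. -/
def invariantForms (M : Submodule ℂ (MvPolynomial (Fin n) ℂ)) :
    Submodule ℂ (MvPolynomial (Fin n) ℂ ⊗[ℂ] Module.Dual ℂ V) :=
  LinearMap.range (M.subtype.rTensor (Module.Dual ℂ V)) ⊓
    ⨅ w ∈ W, LinearMap.eqLocus (formAct b w) LinearMap.id

end Invariants

end UnitaryReflection

end

/-!
The theorem rests on two classical facts about the ideal `I` of `S` generated by the invariants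
without constant term (equivalently, by the basic invariants `f i`) and about the space of harmonic
polynomials, which are the polynomials annihilated by all `(f i)^*`. For the Hermitian inner product
`⟨p, q⟩ = (p^* q)(0)` on `S`, multiplication by `p` is adjoint to `p^*`, so harmonic polynomials are
orthogonal to `I`.

* Steinberg's theorem, `mem_ideal_of_starOp_delta_eq_zero`: `p^* Δ = 0` only for `p ∈ I`. It implies
  that `𝓗` is the space of harmonic polynomials (`harmonics_eq_harmonicSpace`), because a harmonic
  polynomial orthogonal to `𝓗` annihilates `Δ`.
* Chevalley's lemma, `mem_ideal_of_sum_mul_eq_zero`: it implies that the monomials in the `f i` are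
  linearly independent over the harmonic polynomials (`eq_zero_of_sum_aeval_monomial_mul`).

Both proofs use reflections in the same way: a polynomial minus its image under a reflection `s` is
divisible by the linear form of the hyperplane of `s`.

The coefficients of `df_i` are harmonic because `f_j^* ∂_k f_i = ∂_k (f_j^* f_i)` is the derivative
of a constant. Conversely, since each `X j` satisfies a separable equation over the invariants,
every element of `S ⊗ V^*` is a combination of the `df_i` up to a nonzero denominator, and for an
invariant element the denominator and the coefficients can be averaged to become invariant
(`exists_invariant_mul_eq_sum_gradient`). If the element also has harmonic coefficients, then
comparing coefficients of the monomials in the `f i` shows that it is a combination with constant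
coefficients. This determines `(𝓗 ⊗ V^*)^W`, and its image under `ε` follows from Euler's identity
`ε (df_i) = deg f_i • f_i`. As for the graded description of the span of the `f i`, a homogeneous
invariant of positive degree annihilated by all those of smaller positive degree differs from its
orthogonal projection to the span by an element that is both harmonic and in `I`, hence zero.
-/

open MvPolynomial TensorProduct

noncomputable section

namespace UnitaryReflection

/-! ### The star operation and the Hermitian inner product on polynomials -/

section Pairing

variable {n : ℕ}

/-- The multi-index factorial `m! = ∏ i, (m i)!`, as a complex number. -/
def multiFactorial (m : Fin n →₀ ℕ) : ℂ := ∏ i, ((m i).factorial : ℂ)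

theorem multiFactorial_ne_zero (m : Fin n →₀ ℕ) : multiFactorial m ≠ 0 :=
  Finset.prod_ne_zero_iff.mpr fun i _ => by exact_mod_cast (m i).factorial_ne_zero

theorem multiFactorial_add_single (m : Fin n →₀ ℕ) (i : Fin n) :
    multiFactorial (m + Finsupp.single i 1) = (m i + 1) * multiFactorial m := by
  classical
  rw [multiFactorial, multiFactorial, ← Finset.mul_prod_erase _ _ (Finset.mem_univ i),
    ← Finset.mul_prod_erase (a := i) Finset.univ (fun j => ((m j).factorial : ℂ))
      (Finset.mem_univ i), ← mul_assoc]
  congr 1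
  · simp [Nat.factorial_succ]
  · refine Finset.prod_congr rfl fun j hj => ?_
    simp [(Finset.ne_of_mem_erase hj).symm]

/-- The coefficient of `p` at `m` in the basis of divided powers `x^m / m!`. In this basis the
operators `∂^a` are mere shifts of the index. -/
def divCoeff (m : Fin n →₀ ℕ) (p : MvPolynomial (Fin n) ℂ) : ℂ := multiFactorial m * coeff m p

theorem divCoeff_pderiv (m : Fin n →₀ ℕ) (i : Fin n) (p : MvPolynomial (Fin n) ℂ) :
    divCoeff m (pderiv i p) = divCoeff (m + Finsupp.single i 1) p := by
  rw [divCoeff, divCoeff, coeff_pderiv, multiFactorial_add_single]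
  ring

theorem ext_divCoeff {p q : MvPolynomial (Fin n) ℂ} (h : ∀ m, divCoeff m p = divCoeff m q) :
    p = q :=
  MvPolynomial.ext _ _ fun m => mul_left_cancel₀ (multiFactorial_ne_zero m) (h m)

theorem divCoeff_pderiv_pow (m : Fin n →₀ ℕ) (i : Fin n) (k : ℕ) (p : MvPolynomial (Fin n) ℂ) :
    divCoeff m ((((pderiv i).toLinearMap : Module.End ℂ (MvPolynomial (Fin n) ℂ)) ^ k) p) =
      divCoeff (m + Finsupp.single i k) p := by
  induction k generalizing m with
  | zero => simp
  | succ k ih =>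
    rw [pow_succ', Module.End.mul_apply]
    exact (divCoeff_pderiv m i _).trans (by
      rw [ih, add_assoc, ← Finsupp.single_add, add_comm 1 k])

theorem divCoeff_partialPow (m a : Fin n →₀ ℕ) (p : MvPolynomial (Fin n) ℂ) :
    divCoeff m (partialPow a p) = divCoeff (m + a) p := by
  have key : ∀ (l : List (Fin n)) (m : Fin n →₀ ℕ),
      divCoeff m ((l.map fun i =>
        ((pderiv i).toLinearMap : Module.End ℂ (MvPolynomial (Fin n) ℂ)) ^ a i).prod p) =
      divCoeff (m + (l.map fun i => Finsupp.single i (a i)).sum) p := by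
    intro l
    induction l with
    | nil => simp
    | cons i l ih =>
      intro m
      rw [List.map_cons, List.prod_cons, Module.End.mul_apply, divCoeff_pderiv_pow, ih,
        List.map_cons, List.sum_cons, add_assoc]
  rw [partialPow, key, ← List.ofFn_eq_map, List.sum_ofFn]
  congr 2
  exact Finsupp.univ_sum_single a

theorem partialPow_add (a c : Fin n →₀ ℕ) :
    partialPow (a + c) = partialPow a * partialPow c := by
  refine LinearMap.ext fun p => ext_divCoeff fun m => ?_
  rw [Module.End.mul_apply, divCoeff_partialPow, divCoeff_partialPow, divCoeff_partialPow,
    add_assoc]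

theorem starOp_zero : starOp (0 : MvPolynomial (Fin n) ℂ) = 0 := by simp [starOp]

theorem starOp_monomial (a : Fin n →₀ ℕ) (c : ℂ) :
    starOp (monomial a c) = (starRingEnd ℂ) c • partialPow a := by
  rw [starOp_eq_sum_of_subset _ {a} support_monomial_subset]
  simp

theorem starOp_mul (p q : MvPolynomial (Fin n) ℂ) : starOp (p * q) = starOp p * starOp q := by
  induction p using MvPolynomial.induction_on' with
  | add p₁ p₂ h₁ h₂ => rw [add_mul, starOp_add, h₁, h₂, starOp_add, add_mul]
  | monomial a c =>
    induction q using MvPolynomial.induction_on' with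
    | add q₁ q₂ h₁ h₂ => rw [mul_add, starOp_add, h₁, h₂, starOp_add, mul_add]
    | monomial a' c' =>
      rw [monomial_mul, starOp_monomial, starOp_monomial, starOp_monomial, partialPow_add,
        map_mul, smul_mul_smul_comm]

theorem starOp_C (c : ℂ) : starOp (C c : MvPolynomial (Fin n) ℂ) = (starRingEnd ℂ) c • 1 := by
  rw [C_apply, starOp_monomial]
  congr 1
  refine LinearMap.ext fun p => ext_divCoeff fun m => ?_
  rw [divCoeff_partialPow, add_zero, Module.End.one_apply]

theorem starOp_X (i : Fin n) (p : MvPolynomial (Fin n) ℂ) : starOp (X i) p = pderiv i p := by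
  refine ext_divCoeff fun m => ?_
  rw [X, starOp_monomial, map_one, one_smul, divCoeff_partialPow, divCoeff_pderiv]

theorem starOp_comm_apply (p q r : MvPolynomial (Fin n) ℂ) :
    starOp p (starOp q r) = starOp q (starOp p r) := by
  rw [← Module.End.mul_apply, ← starOp_mul, mul_comm, starOp_mul, Module.End.mul_apply]

theorem starOp_sum {ι : Type*} (s : Finset ι) (g : ι → MvPolynomial (Fin n) ℂ) :
    starOp (∑ i ∈ s, g i) = ∑ i ∈ s, starOp (g i) := by
  classical
  induction s using Finset.induction_on with
  | empty => simp [starOp_zero]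
  | insert i s hi ih => rw [Finset.sum_insert hi, Finset.sum_insert hi, starOp_add, ih]

theorem starOp_neg (p : MvPolynomial (Fin n) ℂ) : starOp (-p) = -starOp p :=
  eq_neg_of_add_eq_zero_left (by rw [← starOp_add, neg_add_cancel, starOp_zero])

theorem starOp_sub (p q : MvPolynomial (Fin n) ℂ) : starOp (p - q) = starOp p - starOp q := by
  rw [sub_eq_add_neg, starOp_add, starOp_neg, ← sub_eq_add_neg]

/-- The Hermitian inner product `⟨p, q⟩ = (p^* q)(0)` on `S`, conjugate linear in `p`. -/
def pairing (p : MvPolynomial (Fin n) ℂ) : MvPolynomial (Fin n) ℂ →ₗ[ℂ] ℂ :=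
  lcoeff ℂ 0 ∘ₗ starOp p

theorem pairing_apply (p q : MvPolynomial (Fin n) ℂ) :
    pairing p q = constantCoeff (starOp p q) := rfl

/-- The monomials are orthogonal, and `⟨x^a, x^a⟩ = a!`. -/
theorem pairing_eq_sum (p q : MvPolynomial (Fin n) ℂ) :
    pairing p q = ∑ a ∈ p.support, (starRingEnd ℂ) (coeff a p) * divCoeff a q := by
  have h : ∀ r : MvPolynomial (Fin n) ℂ, constantCoeff r = divCoeff 0 r := fun r => by
    simp [divCoeff, multiFactorial, constantCoeff_eq]
  rw [pairing_apply, starOp, LinearMap.sum_apply, map_sum]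
  refine Finset.sum_congr rfl fun a _ => ?_
  rw [LinearMap.smul_apply, smul_eq_C_mul, map_mul, constantCoeff_C, h, divCoeff_partialPow,
    zero_add]

theorem eq_zero_of_pairing_self {p : MvPolynomial (Fin n) ℂ} (h : pairing p p = 0) : p = 0 := by
  rw [pairing_eq_sum] at h
  have hterm : ∀ a, (starRingEnd ℂ) (coeff a p) * divCoeff a p =
      ((Complex.normSq (coeff a p) * ∏ i, ((a i).factorial : ℝ) : ℝ) : ℂ) := fun a => by
    rw [divCoeff, mul_left_comm, mul_comm, ← Complex.normSq_eq_conj_mul_self, multiFactorial]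
    push_cast
    rfl
  simp_rw [hterm] at h
  rw [← Complex.ofReal_sum, Complex.ofReal_eq_zero, Finset.sum_eq_zero_iff_of_nonneg fun a _ =>
    mul_nonneg (Complex.normSq_nonneg _) (by positivity)] at h
  by_contra hp
  obtain ⟨a, ha⟩ := support_nonempty.mpr hp
  rcases mul_eq_zero.mp (h a ha) with h0 | h0
  · exact mem_support_iff.mp ha (Complex.normSq_eq_zero.mp h0)
  · exact Finset.prod_ne_zero_iff.mpr
      (fun i _ => by exact_mod_cast (a i).factorial_ne_zero) h0

theorem pairing_sum_left {ι : Type*} (s : Finset ι) (g : ι → MvPolynomial (Fin n) ℂ)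
    (r : MvPolynomial (Fin n) ℂ) : pairing (∑ i ∈ s, g i) r = ∑ i ∈ s, pairing (g i) r := by
  rw [pairing_apply, starOp_sum, LinearMap.sum_apply, map_sum]; rfl

theorem pairing_conj_symm (p q : MvPolynomial (Fin n) ℂ) :
    (starRingEnd ℂ) (pairing p q) = pairing q p := by
  have h : ∀ p q : MvPolynomial (Fin n) ℂ, pairing p q =
      ∑ a ∈ p.support ∪ q.support, (starRingEnd ℂ) (coeff a p) * divCoeff a q := fun p q => by
    rw [pairing_eq_sum]
    refine Finset.sum_subset Finset.subset_union_left fun a _ ha => ?_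
    rw [notMem_support_iff.mp ha, map_zero, zero_mul]
  rw [h p q, h q p, Finset.union_comm, map_sum]
  refine Finset.sum_congr rfl fun a _ => ?_
  simp only [divCoeff, multiFactorial, map_mul, Complex.conj_conj, map_prod, map_natCast]
  ring

theorem exists_of_coeff_starOp_ne_zero {p q : MvPolynomial (Fin n) ℂ} {m : Fin n →₀ ℕ}
    (hm : coeff m (starOp p q) ≠ 0) : ∃ a, coeff a p ≠ 0 ∧ coeff (m + a) q ≠ 0 := by
  have h : divCoeff m (starOp p q) =
      ∑ a ∈ p.support, (starRingEnd ℂ) (coeff a p) * divCoeff (m + a) q := by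
    rw [starOp, LinearMap.sum_apply, divCoeff, coeff_sum, Finset.mul_sum]
    refine Finset.sum_congr rfl fun a _ => ?_
    rw [← divCoeff_partialPow, LinearMap.smul_apply, coeff_smul, divCoeff, smul_eq_mul]
    ring
  have h0 : divCoeff m (starOp p q) ≠ 0 := mul_ne_zero (multiFactorial_ne_zero m) hm
  rw [h] at h0
  obtain ⟨a, _, ha⟩ := Finset.exists_ne_zero_of_sum_ne_zero h0
  exact ⟨a, fun h => ha (by rw [h, map_zero, zero_mul]),
    fun h => ha (by rw [divCoeff, h, mul_zero, mul_zero])⟩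

theorem degree_add_eq_of_coeff_starOp_ne_zero {p q : MvPolynomial (Fin n) ℂ} {k l : ℕ}
    (hp : p.IsHomogeneous l) (hq : q.IsHomogeneous k) {m : Fin n →₀ ℕ}
    (hm : coeff m (starOp p q) ≠ 0) : m.degree + l = k := by
  obtain ⟨a, h1, h2⟩ := exists_of_coeff_starOp_ne_zero hm
  have h3 : Finsupp.weight (fun _ => 1) a = l := hp h1
  have h4 : Finsupp.weight (fun _ => 1) (m + a) = k := hq h2
  rw [← Finsupp.degree_eq_weight_one] at h3 h4
  rw [← h3, ← h4, map_add]

theorem totalDegree_starOp_le (p q : MvPolynomial (Fin n) ℂ) :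
    (starOp p q).totalDegree ≤ q.totalDegree := by
  refine Finset.sup_le fun m hm => ?_
  obtain ⟨a, _, h2⟩ := exists_of_coeff_starOp_ne_zero (mem_support_iff.mp hm)
  have h4 := le_totalDegree (mem_support_iff.mpr h2)
  change (m + a).degree ≤ _ at h4
  change m.degree ≤ _
  rw [map_add] at h4
  lia

/-- The operator `p^*` of a polynomial `p` without constant term lowers the degree. -/
theorem totalDegree_starOp_lt {p q : MvPolynomial (Fin n) ℂ} (hp : constantCoeff p = 0)
    (h : starOp p q ≠ 0) : (starOp p q).totalDegree < q.totalDegree := by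
  obtain ⟨m, hm, hmd⟩ := Finset.exists_mem_eq_sup _ (support_nonempty.mpr h)
    (fun m : Fin n →₀ ℕ => m.degree)
  obtain ⟨a, h1, h2⟩ := exists_of_coeff_starOp_ne_zero (mem_support_iff.mp hm)
  have h4 := le_totalDegree (mem_support_iff.mpr h2)
  change (m + a).degree ≤ _ at h4
  have ha : a.degree ≠ 0 := fun h0 => h1 (by
    rw [(Finsupp.degree_eq_zero_iff a).mp h0]; exact hp)
  change Finset.sup _ (fun m : Fin n →₀ ℕ => m.degree) < _
  rw [map_add] at h4
  lia

end Pairing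
/-! ### The action of the unitary group on polynomials -/

section Action

variable {V : Type*} [NormedAddCommGroup V] [InnerProductSpace ℂ V] {n : ℕ}
  (b : OrthonormalBasis (Fin n) ℂ V)

theorem linForm_apply (L : Module.Dual ℂ V) : linForm b L = ∑ j, C (L (b j)) * X j := by
  simp [linForm, smul_eq_C_mul]

theorem linForm_coord (j : Fin n) : linForm b (b.toBasis.coord j) = X j := by
  classical
  rw [linForm_apply, Finset.sum_eq_single j]
  · rw [← b.coe_toBasis, Module.Basis.coord_apply, Module.Basis.repr_self]
    simp
  · intro k _ hk
    rw [← b.coe_toBasis, Module.Basis.coord_apply, Module.Basis.repr_self]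
    simp [hk]
  · simp

theorem coeff_linForm (L : Module.Dual ℂ V) (j : Fin n) :
    coeff (Finsupp.single j 1) (linForm b L) = L (b j) := by
  classical
  rw [linForm_apply, coeff_sum, Finset.sum_eq_single j]
  · simp [coeff_C_mul]
  · intro k _ hk
    rw [coeff_C_mul, coeff_X, if_neg, mul_zero]
    simpa [Finsupp.single_left_inj] using hk
  · simp

theorem linForm_injective : Function.Injective (linForm b) := by
  intro L L' h
  refine b.toBasis.ext fun j => ?_
  rw [b.coe_toBasis, ← coeff_linForm, ← coeff_linForm, h]

theorem isHomogeneous_linForm (L : Module.Dual ℂ V) : (linForm b L).IsHomogeneous 1 := by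
  rw [linForm_apply]
  exact IsHomogeneous.sum _ _ _ fun j _ => by
    simpa using (isHomogeneous_C _ _).mul (isHomogeneous_X ℂ j)

theorem constantCoeff_linForm (L : Module.Dual ℂ V) : constantCoeff (linForm b L) = 0 := by
  simp [linForm_apply]

theorem dualAct_apply (w : V ≃ₗᵢ[ℂ] V) (L : Module.Dual ℂ V) (v : V) :
    dualAct w L v = L (w⁻¹ v) := rfl

theorem dualAct_mul (w w' : V ≃ₗᵢ[ℂ] V) (L : Module.Dual ℂ V) :
    dualAct (w * w') L = dualAct w (dualAct w' L) := by
  ext v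
  rw [dualAct_apply, dualAct_apply, dualAct_apply, mul_inv_rev]
  rfl

theorem polyAct_linForm (w : V ≃ₗᵢ[ℂ] V) (L : Module.Dual ℂ V) :
    polyAct b w (linForm b L) = linForm b (dualAct w L) := by
  have h : L = ∑ j, L (b j) • b.toBasis.coord j := by
    refine b.toBasis.ext fun k => ?_
    classical
    simp [LinearMap.sum_apply]
  conv_rhs => rw [h]
  rw [map_sum, map_sum, linForm_apply, map_sum]
  refine Finset.sum_congr rfl fun j _ => ?_
  rw [map_mul, ← algebraMap_eq, AlgHom.commutes, algebraMap_eq, map_smul, map_smul,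
    smul_eq_C_mul, polyAct, aeval_X]

theorem polyAct_X (w : V ≃ₗᵢ[ℂ] V) (j : Fin n) :
    polyAct b w (X j) = linForm b (dualAct w (b.toBasis.coord j)) := by
  rw [← polyAct_linForm, linForm_coord]

theorem polyAct_one (p : MvPolynomial (Fin n) ℂ) : polyAct b 1 p = p := by
  have : polyAct b 1 = AlgHom.id ℂ _ := algHom_ext fun j => by
    rw [polyAct_X]
    exact linForm_coord b j
  rw [this, AlgHom.id_apply]

theorem polyAct_mul (w w' : V ≃ₗᵢ[ℂ] V) (p : MvPolynomial (Fin n) ℂ) :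
    polyAct b (w * w') p = polyAct b w (polyAct b w' p) := by
  have : polyAct b (w * w') = (polyAct b w).comp (polyAct b w') := algHom_ext fun j => by
    rw [AlgHom.comp_apply, polyAct_X, polyAct_X, polyAct_linForm, dualAct_mul]
  rw [this, AlgHom.comp_apply]

theorem polyAct_inv_polyAct (w : V ≃ₗᵢ[ℂ] V) (p : MvPolynomial (Fin n) ℂ) :
    polyAct b w⁻¹ (polyAct b w p) = p := by
  rw [← polyAct_mul, inv_mul_cancel, polyAct_one]

theorem polyAct_injective (w : V ≃ₗᵢ[ℂ] V) : Function.Injective (polyAct b w) :=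
  Function.LeftInverse.injective (polyAct_inv_polyAct b w)

theorem constantCoeff_polyAct (w : V ≃ₗᵢ[ℂ] V) (p : MvPolynomial (Fin n) ℂ) :
    constantCoeff (polyAct b w p) = constantCoeff p := by
  induction p using MvPolynomial.induction_on with
  | C a => rw [← algebraMap_eq, AlgHom.commutes]
  | add p q hp hq => rw [map_add, map_add, map_add, hp, hq]
  | mul_X p j hp =>
    rw [map_mul, map_mul, map_mul, polyAct_X, constantCoeff_linForm, constantCoeff_X, mul_zero,
      mul_zero]

theorem totalDegree_polyAct_le (w : V ≃ₗᵢ[ℂ] V) (p : MvPolynomial (Fin n) ℂ) :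
    (polyAct b w p).totalDegree ≤ p.totalDegree := by
  conv_lhs => rw [p.as_sum, map_sum]
  refine totalDegree_finsetSum_le fun m hm => ?_
  rw [monomial_eq, map_mul, Finsupp.prod, map_prod]
  have h := isHomogeneous_C (Fin n) (coeff m p)
  have h2 : (polyAct b w (C (coeff m p)) *
      ∏ i ∈ m.support, polyAct b w (X i ^ m i)).IsHomogeneous (0 + ∑ i ∈ m.support, m i) := by
    refine IsHomogeneous.mul ?_ (IsHomogeneous.prod _ _ _ fun i _ => ?_)
    · rw [← algebraMap_eq, AlgHom.commutes]
      exact isHomogeneous_C _ _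
    · rw [map_pow, polyAct_X]
      simpa using (isHomogeneous_linForm b _).pow (m i)
  refine h2.totalDegree_le.trans ?_
  rw [zero_add]
  exact le_totalDegree hm

theorem sum_conj_dualAct_mul (w : V ≃ₗᵢ[ℂ] V) (i j : Fin n) :
    ∑ k, (starRingEnd ℂ) (dualAct w (b.toBasis.coord i) (b k)) *
      dualAct w (b.toBasis.coord j) (b k) = if i = j then 1 else 0 := by
  classical
  have h : ∀ i k, dualAct w (b.toBasis.coord i) (b k) = inner ℂ (w (b i)) (b k) := fun i k => by
    rw [dualAct_apply, Module.Basis.coord_apply, b.coe_toBasis_repr_apply, b.repr_apply_apply,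
      ← w.inner_map_map]
    congr 1
    exact w.apply_symm_apply (b k)
  simp_rw [h, inner_conj_symm, mul_comm (inner ℂ (b _) _)]
  rw [b.sum_inner_mul_inner, w.inner_map_map, b.inner_eq_ite]
  simp [eq_comm]

theorem starOp_linForm (L : Module.Dual ℂ V) (p : MvPolynomial (Fin n) ℂ) :
    starOp (linForm b L) p = ∑ k, C ((starRingEnd ℂ) (L (b k))) * pderiv k p := by
  rw [linForm_apply, starOp_sum, LinearMap.sum_apply]
  refine Finset.sum_congr rfl fun k _ => ?_
  rw [starOp_mul, starOp_C, smul_one_mul, LinearMap.smul_apply, starOp_X, smul_eq_C_mul]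

theorem pderiv_polyAct_X (w : V ≃ₗᵢ[ℂ] V) (j k : Fin n) :
    pderiv k (polyAct b w (X j)) = C (dualAct w (b.toBasis.coord j) (b k)) := by
  classical
  rw [polyAct_X, linForm_apply, map_sum, Finset.sum_eq_single k]
  · simp
  · intro l _ hl
    simp [hl]
  · simp

theorem starOp_linForm_polyAct (w : V ≃ₗᵢ[ℂ] V) (i : Fin n) (p : MvPolynomial (Fin n) ℂ) :
    starOp (polyAct b w (X i)) (polyAct b w p) = polyAct b w (pderiv i p) := by
  classical
  rw [polyAct_X, starOp_linForm]
  induction p using MvPolynomial.induction_on with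
  | C a => simp [← algebraMap_eq]
  | add p q hp hq =>
    simp only [map_add, mul_add, Finset.sum_add_distrib, hp, hq]
  | mul_X p j hp =>
    have e : ∀ k, C ((starRingEnd ℂ) (dualAct w (b.toBasis.coord i) (b k))) *
        pderiv k (polyAct b w (p * X j)) =
        C ((starRingEnd ℂ) (dualAct w (b.toBasis.coord i) (b k))) * pderiv k (polyAct b w p) *
          polyAct b w (X j) + polyAct b w p *
          C ((starRingEnd ℂ) (dualAct w (b.toBasis.coord i) (b k)) *
            dualAct w (b.toBasis.coord j) (b k)) := by
      intro k
      rw [map_mul, pderiv_mul, pderiv_polyAct_X, C_mul]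
      ring
    rw [Finset.sum_congr rfl fun k _ => e k, Finset.sum_add_distrib, ← Finset.sum_mul, hp,
      ← Finset.mul_sum, ← map_sum, sum_conj_dualAct_mul, pderiv_mul, map_add, map_mul, map_mul]
    by_cases hij : i = j
    · subst hij
      rw [if_pos rfl, pderiv_X_self, C_1, map_one]
    · rw [if_neg hij, pderiv_X_of_ne (Ne.symm hij), C_0, map_zero]

/-- Since `w` is unitary, the star operation is equivariant. -/
theorem starOp_polyAct (w : V ≃ₗᵢ[ℂ] V) (q p : MvPolynomial (Fin n) ℂ) :
    starOp (polyAct b w q) (polyAct b w p) = polyAct b w (starOp q p) := by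
  induction q using MvPolynomial.induction_on generalizing p with
  | C a =>
    rw [← algebraMap_eq, AlgHom.commutes, algebraMap_eq, starOp_C, LinearMap.smul_apply,
      LinearMap.smul_apply, map_smul]
    rfl
  | add p q hp hq => rw [map_add, starOp_add, starOp_add, LinearMap.add_apply, hp, hq,
      LinearMap.add_apply, map_add]
  | mul_X q j hq =>
    rw [map_mul, starOp_mul, starOp_mul, Module.End.mul_apply, starOp_linForm_polyAct, hq,
      Module.End.mul_apply, starOp_X]

theorem pderiv_polyAct (w : V ≃ₗᵢ[ℂ] V) (k : Fin n) (p : MvPolynomial (Fin n) ℂ) :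
    pderiv k (polyAct b w p) =
      ∑ j, C (dualAct w (b.toBasis.coord j) (b k)) * polyAct b w (pderiv j p) := by
  classical
  induction p using MvPolynomial.induction_on with
  | C a => simp [← algebraMap_eq]
  | add p q hp hq => simp only [map_add, mul_add, Finset.sum_add_distrib, hp, hq]
  | mul_X p i hp =>
    have e : ∀ j, C (dualAct w (b.toBasis.coord j) (b k)) * polyAct b w (pderiv j (p * X i)) =
        C (dualAct w (b.toBasis.coord j) (b k)) * polyAct b w (pderiv j p) * polyAct b w (X i) +
          polyAct b w p * (C (dualAct w (b.toBasis.coord j) (b k)) *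
            polyAct b w (pderiv j (X i))) := by
      intro j
      rw [pderiv_mul, map_add, map_mul, map_mul]
      ring
    rw [Finset.sum_congr rfl fun j _ => e j, Finset.sum_add_distrib, ← Finset.sum_mul, ← hp,
      ← Finset.mul_sum, map_mul, pderiv_mul, pderiv_polyAct_X]
    congr 2
    rw [Finset.sum_eq_single i]
    · rw [pderiv_X_self, map_one, mul_one]
    · intro j _ hj
      rw [pderiv_X_of_ne hj.symm, map_zero, mul_zero]
    · simp

theorem exists_smul_of_ker_le {L L' : Module.Dual ℂ V} (h : LinearMap.ker L ≤ LinearMap.ker L') :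
    ∃ c : ℂ, L' = c • L := by
  by_cases hL : L = 0
  · refine ⟨0, ?_⟩
    subst hL
    rw [zero_smul]
    exact LinearMap.ext fun v => h (by simp)
  · obtain ⟨u, hu⟩ : ∃ u, L u ≠ 0 := by
      by_contra hc
      push Not at hc
      exact hL (LinearMap.ext hc)
    refine ⟨L' u / L u, LinearMap.ext fun v => ?_⟩
    have h1 : L' (v - (L v / L u) • u) = 0 := h (by simp [hu])
    rw [map_sub, map_smul, sub_eq_zero] at h1
    rw [h1, LinearMap.smul_apply, smul_eq_mul, smul_eq_mul]
    ring

/-- A transformation that fixes the hyperplane `ker L` pointwise acts trivially modulo `L`. -/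
theorem linForm_dvd_sub_polyAct {L : Module.Dual ℂ V} {w : V ≃ₗᵢ[ℂ] V}
    (hw : ∀ v, L v = 0 → w v = v) (p : MvPolynomial (Fin n) ℂ) :
    linForm b L ∣ p - polyAct b w p := by
  induction p using MvPolynomial.induction_on with
  | C a => rw [← algebraMap_eq, AlgHom.commutes, sub_self]; exact dvd_zero _
  | add p q hp hq =>
    rw [map_add, add_sub_add_comm]
    exact dvd_add hp hq
  | mul_X p j hp =>
    have h : linForm b L ∣ X j - polyAct b w (X j) := by
      rw [polyAct_X]
      obtain ⟨c, hc⟩ := exists_smul_of_ker_le (L := L)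
        (L' := b.toBasis.coord j - dualAct w (b.toBasis.coord j)) fun v hv => by
          have h1 : w⁻¹ v = v := w.symm_apply_eq.mpr (hw v hv).symm
          rw [LinearMap.mem_ker, LinearMap.sub_apply, dualAct_apply, h1, sub_self]
      nth_rw 1 [← linForm_coord b j]
      rw [← map_sub, hc, map_smul, smul_eq_C_mul]
      exact Dvd.intro_left _ rfl
    have e : p * X j - polyAct b w (p * X j) =
        (p - polyAct b w p) * X j + polyAct b w p * (X j - polyAct b w (X j)) := by
      rw [map_mul]; ring
    rw [e]
    exact dvd_add (hp.mul_right _) (h.mul_left _)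

theorem prime_linForm {L : Module.Dual ℂ V} (hL : L ≠ 0) : Prime (linForm b L) := by
  have h0 : linForm b L ≠ 0 := fun h => hL (linForm_injective b (by rw [h, map_zero]))
  refine (irreducible_of_totalDegree_eq_one ((isHomogeneous_linForm b L).totalDegree h0)
    fun c hc => ?_).prime
  obtain ⟨j, hj⟩ : ∃ j, coeff (Finsupp.single j 1) (linForm b L) ≠ 0 := by
    by_contra hc
    push Not at hc
    exact hL (b.toBasis.ext fun j => by
      rw [b.coe_toBasis, ← coeff_linForm, hc]; rfl)
  exact isUnit_iff_ne_zero.mpr fun h => hj (by simpa [h] using hc (Finsupp.single j 1))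

theorem ker_eq_of_linForm_dvd {L L' : Module.Dual ℂ V} (hL' : L' ≠ 0)
    (h : linForm b L ∣ linForm b L') : LinearMap.ker L = LinearMap.ker L' := by
  obtain ⟨q, hq⟩ := h
  have h0 : linForm b L' ≠ 0 := fun h => hL' (linForm_injective b (by rw [h, map_zero]))
  have hL : linForm b L ≠ 0 := fun h => h0 (by rw [hq, h, zero_mul])
  have hq0 : q ≠ 0 := fun h => h0 (by rw [hq, h, mul_zero])
  have hd := totalDegree_mul_of_isDomain hL hq0
  rw [← hq, (isHomogeneous_linForm b L).totalDegree hL,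
    (isHomogeneous_linForm b L').totalDegree h0] at hd
  rw [totalDegree_eq_zero_iff_eq_C.mp (show q.totalDegree = 0 by lia), mul_comm, ← smul_eq_C_mul,
    ← map_smul] at hq
  have hc : coeff 0 q ≠ 0 := fun h => hL' (by
    rw [linForm_injective b hq, h, zero_smul])
  rw [linForm_injective b hq, LinearMap.ker_smul _ _ hc]

end Action
/-! ### Reflecting hyperplanes and their pointwise stabilizers -/

section Hyperplanes

variable {V : Type*} [NormedAddCommGroup V] [InnerProductSpace ℂ V]

/-- The group of the elements of `W` that fix `H` pointwise. -/
def pointwiseStabilizer (W : Subgroup (V ≃ₗᵢ[ℂ] V)) (H : Submodule ℂ V) :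
    Subgroup (V ≃ₗᵢ[ℂ] V) where
  carrier := {w | w ∈ W ∧ ∀ v ∈ H, w v = v}
  mul_mem' := fun {w w'} h h' => ⟨mul_mem h.1 h'.1, fun v hv => by
    change w (w' v) = v
    rw [h'.2 v hv, h.2 v hv]⟩
  one_mem' := ⟨one_mem _, fun _ _ => rfl⟩
  inv_mem' := fun {w} h => ⟨inv_mem h.1, fun v hv => w.symm_apply_eq.mpr (h.2 v hv).symm⟩

theorem natCard_pointwiseStabilizer (W : Subgroup (V ≃ₗᵢ[ℂ] V)) (H : Submodule ℂ V) :
    Nat.card (pointwiseStabilizer W H) = hyperplaneOrder W H := rfl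

theorem exists_dualAct_eq_smul {L : Module.Dual ℂ V} {w : V ≃ₗᵢ[ℂ] V}
    (hw : ∀ v, L v = 0 → w v = v) : ∃ c : ℂ, dualAct w L = c • L :=
  exists_smul_of_ker_le fun v hv => by
    have h1 : w⁻¹ v = v := w.symm_apply_eq.mpr (hw v hv).symm
    rw [LinearMap.mem_ker, dualAct_apply, h1]
    exact hv

/-- A unitary transformation that fixes the hyperplane `ker L` pointwise is determined by its
eigenvalue on `L`: `w v - v` lies in the hyperplane and is orthogonal to it. -/
theorem eq_one_of_dualAct_eq {L : Module.Dual ℂ V} {w : V ≃ₗᵢ[ℂ] V}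
    (hw : ∀ v, L v = 0 → w v = v) (h : dualAct w L = L) : w = 1 := by
  ext v
  have h1 : L (w v) = L v := by
    rw [← congrArg (fun M : Module.Dual ℂ V => M (w v)) h]
    exact congrArg L (w.symm_apply_apply v)
  have h2 : L (w v - v) = 0 := by rw [map_sub, h1, sub_self]
  have h3 : inner ℂ (w v - v) (w v - v) = 0 := by
    rw [inner_sub_right, sub_eq_zero]
    conv_lhs => rw [← hw _ h2]
    rw [w.inner_map_map]
  exact sub_eq_zero.mp (inner_self_eq_zero.mp h3)

/-- The eigenvalues on `L` identify the pointwise stabilizer of `ker L` with a finite group of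
scalars, so it is cyclic, and a generator acts on `L` by a primitive root of unity. -/
theorem exists_primitive_generator {W : Subgroup (V ≃ₗᵢ[ℂ] V)} (hW : Finite W)
    {L : Module.Dual ℂ V} (hL : L ≠ 0) :
    (∃ w ∈ pointwiseStabilizer W (LinearMap.ker L), ∃ ζ : ℂ,
      IsPrimitiveRoot ζ (hyperplaneOrder W (LinearMap.ker L)) ∧ dualAct w L = ζ • L) ∧
    0 < hyperplaneOrder W (LinearMap.ker L) ∧
    ∀ w ∈ pointwiseStabilizer W (LinearMap.ker L), ∀ ζ : ℂ, dualAct w L = ζ • L →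
      ζ ^ hyperplaneOrder W (LinearMap.ker L) = 1 := by
  set G := pointwiseStabilizer W (LinearMap.ker L) with hG
  have hfin : Finite G := Finite.Set.subset (W : Set (V ≃ₗᵢ[ℂ] V)) fun w hw => hw.1
  obtain ⟨u, hu⟩ : ∃ u, L u = 1 := by
    obtain ⟨u, hu⟩ : ∃ u, L u ≠ 0 := by
      by_contra hc
      push Not at hc
      exact hL (LinearMap.ext hc)
    exact ⟨(L u)⁻¹ • u, by rw [map_smul, smul_eq_mul, inv_mul_cancel₀ hu]⟩
  have hev : ∀ w ∈ G, dualAct w L = (dualAct w L u) • L := fun w hw => by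
    obtain ⟨c, hc⟩ := exists_dualAct_eq_smul (L := L) (w := w) hw.2
    rw [hc, LinearMap.smul_apply, hu, smul_eq_mul, mul_one]
  let φ : G →* ℂ :=
    { toFun := fun w => dualAct (w : V ≃ₗᵢ[ℂ] V) L u
      map_one' := hu
      map_mul' := fun w w' => by
        rw [Subgroup.coe_mul, dualAct_mul, hev w' w'.2, map_smul, LinearMap.smul_apply,
          smul_eq_mul, mul_comm, LinearMap.smul_apply, hu, smul_eq_mul, mul_one] }
  have hφ : Function.Injective φ := by
    rw [injective_iff_map_eq_one]
    intro w hw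
    refine Subtype.ext (eq_one_of_dualAct_eq (L := L) w.2.2 ?_)
    rw [hev w w.2]
    exact (congrArg (· • L) hw).trans (one_smul _ _)
  have hcyc : IsCyclic G := isCyclic_of_injective_ringHom φ hφ
  obtain ⟨g, hg⟩ := hcyc.exists_generator
  have hord : orderOf (φ g) = hyperplaneOrder W (LinearMap.ker L) := by
    rw [orderOf_injective φ hφ, orderOf_eq_card_of_forall_mem_zpowers hg]
    exact natCard_pointwiseStabilizer W _
  refine ⟨⟨g, g.2, φ g, hord ▸ IsPrimitiveRoot.orderOf (φ g), hev g g.2⟩, Nat.card_pos (α := G),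
    fun w hw ζ hζ => ?_⟩
  have h1 : φ ⟨w, hw⟩ = ζ := by
    change dualAct w L u = ζ
    rw [hζ, LinearMap.smul_apply, hu, smul_eq_mul, mul_one]
  rw [← h1, ← map_pow, ← natCard_pointwiseStabilizer, pow_card_eq_one', map_one]

theorem finite_reflectingHyperplanes {W : Subgroup (V ≃ₗᵢ[ℂ] V)} (hW : Finite W) :
    (reflectingHyperplanes W).Finite :=
  ((Set.toFinite (W : Set (V ≃ₗᵢ[ℂ] V))).image fixedSpace).subset
    fun _ ⟨s, hs, _, h⟩ => ⟨s, hs, h⟩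

theorem ne_zero_of_ker_eq {W : Subgroup (V ≃ₗᵢ[ℂ] V)} {H : Submodule ℂ V}
    (hH : H ∈ reflectingHyperplanes W) {L : Module.Dual ℂ V} (hL : LinearMap.ker L = H) :
    L ≠ 0 := by
  rintro rfl
  obtain ⟨s, _, hs, rfl⟩ := hH
  rw [IsReflection, ← hL, LinearMap.ker_zero, finrank_top] at hs
  lia

/-- The image `w H` of a subspace `H`. -/
def translate (w : V ≃ₗᵢ[ℂ] V) (H : Submodule ℂ V) : Submodule ℂ V :=
  H.comap (w⁻¹ : V ≃ₗᵢ[ℂ] V).toLinearEquiv.toLinearMap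

theorem mem_translate {w : V ≃ₗᵢ[ℂ] V} {H : Submodule ℂ V} {v : V} :
    v ∈ translate w H ↔ w⁻¹ v ∈ H := Iff.rfl

theorem translate_translate (w w' : V ≃ₗᵢ[ℂ] V) (H : Submodule ℂ V) :
    translate w (translate w' H) = translate (w * w') H := by
  ext v
  rw [mem_translate, mem_translate, mem_translate, mul_inv_rev]
  rfl

theorem translate_one (H : Submodule ℂ V) : translate 1 H = H := rfl

theorem ker_dualAct (w : V ≃ₗᵢ[ℂ] V) (L : Module.Dual ℂ V) :
    LinearMap.ker (dualAct w L) = translate w (LinearMap.ker L) := rfl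

theorem fixedSpace_conj (w s : V ≃ₗᵢ[ℂ] V) :
    fixedSpace (w * s * w⁻¹) = translate w (fixedSpace s) := by
  ext v
  change w (s (w⁻¹ v)) = v ↔ s (w⁻¹ v) = w⁻¹ v
  exact (w.toEquiv.eq_symm_apply).symm

theorem translate_mem_reflectingHyperplanes {W : Subgroup (V ≃ₗᵢ[ℂ] V)} {w : V ≃ₗᵢ[ℂ] V}
    (hw : w ∈ W) {H : Submodule ℂ V} (hH : H ∈ reflectingHyperplanes W) :
    translate w H ∈ reflectingHyperplanes W := by
  obtain ⟨s, hs, hr, rfl⟩ := hH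
  refine ⟨w * s * w⁻¹, mul_mem (mul_mem hw hs) (inv_mem hw), ?_, fixedSpace_conj w s⟩
  rw [IsReflection, fixedSpace_conj, translate, Submodule.comap_equiv_eq_map_symm,
    LinearEquiv.finrank_map_eq]
  exact hr

theorem hyperplaneOrder_translate {W : Subgroup (V ≃ₗᵢ[ℂ] V)} {w : V ≃ₗᵢ[ℂ] V}
    (hw : w ∈ W) (H : Submodule ℂ V) :
    hyperplaneOrder W (translate w H) = hyperplaneOrder W H := by
  refine (Nat.card_congr ((MulAut.conj w).toEquiv.subtypeEquiv fun u => ?_)).symm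
  change (u ∈ W ∧ ∀ v ∈ H, u v = v) ↔ (w * u * w⁻¹ ∈ W ∧ ∀ v ∈ translate w H, w (u (w⁻¹ v)) = v)
  refine and_congr ?_ ⟨fun h v hv => ?_, fun h v hv => ?_⟩
  · rw [Subgroup.mul_mem_cancel_right W (inv_mem hw), Subgroup.mul_mem_cancel_left W hw]
  · have e : u (w⁻¹ v) = w⁻¹ v := h _ hv
    rw [e]
    exact w.apply_symm_apply v
  · have e : w⁻¹ (w v) = v := w.symm_apply_apply v
    have := h (w v) (by rw [mem_translate, e]; exact hv)
    rw [e] at this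
    exact w.injective this

end Hyperplanes

/-! ### The semi-invariant `Δ` -/

section Delta

variable {V : Type*} [NormedAddCommGroup V] [InnerProductSpace ℂ V] {n : ℕ}
  (b : OrthonormalBasis (Fin n) ℂ V)

/-- If `w` fixes `ker L` pointwise and multiplies both `L` and `q` by scalars, then the scalar
of `q` is determined by the exact power of `L` that divides `q`. -/
theorem eq_pow_of_polyAct_eq_smul {L : Module.Dual ℂ V} (hL0 : L ≠ 0) {w : V ≃ₗᵢ[ℂ] V}
    (hw : ∀ v, L v = 0 → w v = v) {ζ c : ℂ} (hζ : dualAct w L = ζ • L)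
    {q : MvPolynomial (Fin n) ℂ} {k : ℕ} (hq : ¬ linForm b L ∣ q)
    (hc : polyAct b w (linForm b L ^ k * q) = c • (linForm b L ^ k * q)) : c = ζ ^ k := by
  have hL : linForm b L ^ k ≠ 0 := pow_ne_zero _ (prime_linForm b hL0).ne_zero
  rw [map_mul, map_pow, polyAct_linForm, hζ, map_smul, smul_pow, smul_mul_assoc, ← mul_smul_comm,
    ← mul_smul_comm] at hc
  have h1 := mul_left_cancel₀ hL hc
  by_contra hne
  refine hq ?_
  have h2 := (linForm_dvd_sub_polyAct b hw q).mul_left (C (ζ ^ k))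
  rw [mul_sub, ← smul_eq_C_mul, ← smul_eq_C_mul, h1, ← sub_smul] at h2
  have h3 := h2.mul_left (C (ζ ^ k - c)⁻¹)
  rwa [← smul_eq_C_mul, smul_smul, inv_mul_cancel₀ (sub_ne_zero.mpr (Ne.symm hne)), one_smul]
    at h3

variable {W : Subgroup (V ≃ₗᵢ[ℂ] V)} {L : Submodule ℂ V → Module.Dual ℂ V}

theorem delta_eq_prod (hW : Finite W) : delta b W L =
    ∏ H ∈ (finite_reflectingHyperplanes hW).toFinset,
      linForm b (L H) ^ (hyperplaneOrder W H - 1) :=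
  finprod_mem_eq_finite_toFinset_prod _ _

theorem delta_ne_zero (hW : Finite W)
    (hL : ∀ H ∈ reflectingHyperplanes W, LinearMap.ker (L H) = H) : delta b W L ≠ 0 := by
  rw [delta_eq_prod b hW]
  exact Finset.prod_ne_zero_iff.mpr fun H hH => pow_ne_zero _ (prime_linForm b
    (ne_zero_of_ker_eq ((Set.Finite.mem_toFinset _).mp hH)
      (hL H ((Set.Finite.mem_toFinset _).mp hH)))).ne_zero

/-- `Δ` is a semi-invariant, because `W` permutes the reflecting hyperplanes. -/
theorem exists_polyAct_delta (hW : Finite W)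
    (hL : ∀ H ∈ reflectingHyperplanes W, LinearMap.ker (L H) = H) {w : V ≃ₗᵢ[ℂ] V} (hw : w ∈ W) :
    ∃ c : ℂ, polyAct b w (delta b W L) = c • delta b W L := by
  have h : ∀ H ∈ reflectingHyperplanes W, ∃ c : ℂ,
      dualAct w (L H) = c • L (translate w H) := fun H hH => by
    refine exists_smul_of_ker_le ?_
    rw [ker_dualAct, hL H hH, hL _ (translate_mem_reflectingHyperplanes hw hH)]
  choose! c hc using h
  refine ⟨∏ H ∈ (finite_reflectingHyperplanes hW).toFinset, c H ^ (hyperplaneOrder W H - 1), ?_⟩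
  rw [delta_eq_prod b hW, map_prod]
  have h1 : ∀ H ∈ (finite_reflectingHyperplanes hW).toFinset,
      polyAct b w (linForm b (L H) ^ (hyperplaneOrder W H - 1)) =
      C (c H ^ (hyperplaneOrder W H - 1)) *
        linForm b (L (translate w H)) ^ (hyperplaneOrder W (translate w H) - 1) := fun H hH => by
    rw [Set.Finite.mem_toFinset] at hH
    rw [map_pow, polyAct_linForm, hc H hH, map_smul, smul_pow, smul_eq_C_mul,
      hyperplaneOrder_translate hw]
  rw [Finset.prod_congr rfl h1, Finset.prod_mul_distrib, ← map_prod, smul_eq_C_mul]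
  congr 1
  refine Finset.prod_bij' (fun H _ => translate w H) (fun H _ => translate w⁻¹ H) ?_ ?_ ?_ ?_ ?_
  · simpa using fun H hH => translate_mem_reflectingHyperplanes hw hH
  · simpa using fun H hH => translate_mem_reflectingHyperplanes (inv_mem hw) hH
  · intro H _
    rw [translate_translate, inv_mul_cancel, translate_one]
  · intro H _
    rw [translate_translate, mul_inv_cancel, translate_one]
  · intro H _
    rfl

/-- The exact power of `L_H` that divides `Δ` is `e_H - 1`. -/
theorem exists_delta_eq_mul (hW : Finite W)
    (hL : ∀ H ∈ reflectingHyperplanes W, LinearMap.ker (L H) = H) {H : Submodule ℂ V}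
    (hH : H ∈ reflectingHyperplanes W) :
    ∃ q, ¬ linForm b (L H) ∣ q ∧
      delta b W L = linForm b (L H) ^ (hyperplaneOrder W H - 1) * q := by
  classical
  have hp := prime_linForm b (ne_zero_of_ker_eq hH (hL H hH))
  refine ⟨_, fun hd => ?_, by
    rw [delta_eq_prod b hW, ← Finset.mul_prod_erase _ _ ((Set.Finite.mem_toFinset _).mpr hH)]⟩
  obtain ⟨H', hH', hd'⟩ := (hp.dvd_finsetProd_iff _).mp hd
  rw [Finset.mem_erase, Set.Finite.mem_toFinset] at hH'
  have := ker_eq_of_linForm_dvd b (ne_zero_of_ker_eq hH'.2 (hL _ hH'.2)) (hp.dvd_of_dvd_pow hd')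
  rw [hL _ hH, hL _ hH'.2] at this
  exact hH'.1 this.symm

/-- The eigenvalues of an element that fixes `H` pointwise on `Δ` and on `L_H` are inverse to each
other. -/
theorem delta_eigenvalue_mul (hW : Finite W)
    (hL : ∀ H ∈ reflectingHyperplanes W, LinearMap.ker (L H) = H) {H : Submodule ℂ V}
    (hH : H ∈ reflectingHyperplanes W) {w : V ≃ₗᵢ[ℂ] V} (hw : w ∈ pointwiseStabilizer W H)
    {ζ c : ℂ} (hζ : dualAct w (L H) = ζ • L H)
    (hc : polyAct b w (delta b W L) = c • delta b W L) : c * ζ = 1 := by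
  obtain ⟨q, hq, hd⟩ := exists_delta_eq_mul b hW hL hH
  have hker := hL H hH
  obtain ⟨-, hpos, hroot⟩ := exists_primitive_generator hW (ne_zero_of_ker_eq hH hker)
  rw [hker] at hpos hroot
  rw [hd] at hc
  rw [eq_pow_of_polyAct_eq_smul b (ne_zero_of_ker_eq hH hker) (fun v hv => hw.2 v (hker ▸ hv))
    hζ hq hc, ← pow_succ, Nat.sub_add_cancel hpos, hroot w hw ζ hζ]

/-- Every polynomial that transforms under `W` like `Δ` is the product of `Δ` and an invariant. -/
theorem exists_eq_delta_mul (hW : Finite W)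
    (hL : ∀ H ∈ reflectingHyperplanes W, LinearMap.ker (L H) = H) {χ : W → ℂ}
    (hχ : ∀ w : W, polyAct b w (delta b W L) = χ w • delta b W L)
    {q : MvPolynomial (Fin n) ℂ} (hq : ∀ w : W, polyAct b w q = χ w • q) :
    ∃ r ∈ invariants b W, q = delta b W L * r := by
  by_cases hq0 : q = 0
  · exact ⟨0, zero_mem _, by rw [hq0, mul_zero]⟩
  have hdvd : delta b W L ∣ q := by
    rw [delta_eq_prod b hW]
    refine Finset.prod_dvd_of_isRelPrime (fun H hH H' hH' hne => ?_) fun H hH => ?_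
    · rw [Finset.mem_coe, Set.Finite.mem_toFinset] at hH hH'
      refine IsRelPrime.pow ((prime_linForm b
        (ne_zero_of_ker_eq hH (hL H hH))).irreducible.isRelPrime_iff_not_dvd.mpr fun hd => hne ?_)
      have := ker_eq_of_linForm_dvd b (ne_zero_of_ker_eq hH' (hL _ hH')) hd
      rwa [hL _ hH, hL _ hH'] at this
    · rw [Set.Finite.mem_toFinset] at hH
      have hL0 := ne_zero_of_ker_eq hH (hL H hH)
      obtain ⟨q', hq', hnd⟩ := (FiniteMultiplicity.of_prime_left (prime_linForm b hL0)
        hq0).exists_eq_pow_mul_and_not_dvd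
      -- A generator of the stabilizer acts on `L_H` by a primitive root of unity `ζ` and on `Δ` by
      -- `ζ⁻¹`, so `ζ ^ (k + 1) = 1` for the exact power `k` of `L_H` in `q`.
      obtain ⟨⟨w, hw, ζ, hprim, hζ⟩, hpos, -⟩ := exists_primitive_generator hW hL0
      have h1 := hq ⟨w, hw.1⟩
      rw [hq'] at h1
      have h2 := eq_pow_of_polyAct_eq_smul b hL0 (fun v hv => hw.2 v hv) hζ hnd h1
      have h3 := delta_eigenvalue_mul b hW hL hH ((hL H hH) ▸ hw) hζ (hχ ⟨w, hw.1⟩)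
      rw [h2, ← pow_succ] at h3
      have h4 := Nat.le_of_dvd (Nat.succ_pos _) (hprim.dvd_of_pow_eq_one _ h3)
      rw [hL H hH] at h4
      rw [hq']
      exact (pow_dvd_pow _ (by lia)).mul_right _
  obtain ⟨r, hr⟩ := hdvd
  refine ⟨r, fun w hw => ?_, hr⟩
  have hΔ := delta_ne_zero b hW hL
  have hχ0 : χ ⟨w, hw⟩ ≠ 0 := fun h0 => hΔ (polyAct_injective b w (by
    rw [hχ ⟨w, hw⟩, h0, zero_smul, map_zero]))
  have h1 := hq ⟨w, hw⟩
  rw [hr, map_mul, hχ ⟨w, hw⟩, smul_mul_assoc] at h1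
  exact mul_left_cancel₀ hΔ (smul_right_injective _ hχ0 h1)

/-- The linear character of `W` by which `Δ` transforms. -/
theorem exists_delta_character (hW : Finite W)
    (hL : ∀ H ∈ reflectingHyperplanes W, LinearMap.ker (L H) = H) :
    ∃ χ : W →* ℂ, ∀ w : W, polyAct b w (delta b W L) = χ w • delta b W L := by
  choose χ hχ using fun w : W => exists_polyAct_delta b hW hL w.2
  have hinj := smul_left_injective ℂ (delta_ne_zero b hW hL)
  refine ⟨⟨⟨χ, hinj ?_⟩, fun w w' => hinj ?_⟩, hχ⟩
  · change χ 1 • delta b W L = (1 : ℂ) • delta b W L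
    rw [← hχ, one_smul]
    exact polyAct_one b _
  · change χ (w * w') • delta b W L = (χ w * χ w') • delta b W L
    rw [← hχ, Subgroup.coe_mul, polyAct_mul, hχ, map_smul, hχ, smul_smul, mul_comm]

end Delta
/-! ### Invariants and the ideal that they generate -/

section Ideal

variable {V : Type*} [NormedAddCommGroup V] [InnerProductSpace ℂ V] {n : ℕ}
  (b : OrthonormalBasis (Fin n) ℂ V) (W : Subgroup (V ≃ₗᵢ[ℂ] V))

theorem mem_invariants {p : MvPolynomial (Fin n) ℂ} :
    p ∈ invariants b W ↔ ∀ w ∈ W, polyAct b w p = p := Iff.rfl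

/-- The sum of the translates of `p` under `W`. -/
def orbitSum [Fintype W] : MvPolynomial (Fin n) ℂ →ₗ[ℂ] MvPolynomial (Fin n) ℂ :=
  ∑ w : W, (polyAct b (w : V ≃ₗᵢ[ℂ] V)).toLinearMap

variable {W}

theorem orbitSum_apply [Fintype W] (p : MvPolynomial (Fin n) ℂ) :
    orbitSum b W p = ∑ w : W, polyAct b (w : V ≃ₗᵢ[ℂ] V) p := by
  simp [orbitSum, LinearMap.sum_apply]

theorem orbitSum_mem [Fintype W] (p : MvPolynomial (Fin n) ℂ) :
    orbitSum b W p ∈ invariants b W := by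
  refine (mem_invariants b W).mpr fun w hw => ?_
  rw [orbitSum_apply, map_sum]
  refine Fintype.sum_equiv (Equiv.mulLeft ⟨w, hw⟩) _ _ fun u => ?_
  rw [Equiv.coe_mulLeft, Subgroup.coe_mul, polyAct_mul]

theorem orbitSum_mul [Fintype W] {r : MvPolynomial (Fin n) ℂ} (hr : r ∈ invariants b W)
    (p : MvPolynomial (Fin n) ℂ) : orbitSum b W (r * p) = r * orbitSum b W p := by
  rw [orbitSum_apply, orbitSum_apply, Finset.mul_sum]
  exact Finset.sum_congr rfl fun w _ => by rw [map_mul, hr w w.2]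

variable {f : Fin n → MvPolynomial (Fin n) ℂ}

theorem mem_invariants_of_generate (hgen : Algebra.adjoin ℂ (Set.range f) = invariants b W)
    (i : Fin n) : f i ∈ invariants b W :=
  hgen ▸ Algebra.subset_adjoin ⟨i, rfl⟩

/-- The ideal generated by the `f i` contains all invariants without constant term. -/
theorem sub_constantCoeff_mem (hgen : Algebra.adjoin ℂ (Set.range f) = invariants b W)
    (hf0 : ∀ i, constantCoeff (f i) = 0) {r : MvPolynomial (Fin n) ℂ} (hr : r ∈ invariants b W) :
    r - C (constantCoeff r) ∈ Ideal.span (Set.range f) := by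
  rw [← hgen] at hr
  induction hr using Algebra.adjoin_induction with
  | mem x hx =>
    obtain ⟨i, rfl⟩ := hx
    rw [hf0, C_0, sub_zero]
    exact Ideal.subset_span ⟨i, rfl⟩
  | algebraMap c => rw [algebraMap_eq, constantCoeff_C, sub_self]; exact zero_mem _
  | add p q _ _ hp hq =>
    rw [map_add, C_add, add_sub_add_comm]
    exact add_mem hp hq
  | mul p q _ _ hp hq =>
    have e : p * q - C (constantCoeff (p * q)) = q * (p - C (constantCoeff p)) +
        C (constantCoeff p) * (q - C (constantCoeff q)) := by
      rw [map_mul, C_mul]; ring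
    rw [e]
    exact add_mem (Ideal.mul_mem_left _ _ hp) (Ideal.mul_mem_left _ _ hq)

theorem polyAct_mem_ideal (hinv : ∀ i, f i ∈ invariants b W) {w : V ≃ₗᵢ[ℂ] V} (hw : w ∈ W)
    {p : MvPolynomial (Fin n) ℂ} (hp : p ∈ Ideal.span (Set.range f)) :
    polyAct b w p ∈ Ideal.span (Set.range f) := by
  obtain ⟨g, rfl⟩ := Ideal.mem_span_range_iff_exists_fun.mp hp
  rw [map_sum]
  refine sum_mem fun i _ => ?_
  rw [map_mul, hinv i w hw]
  exact Ideal.mul_mem_left _ _ (Ideal.subset_span ⟨i, rfl⟩)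

/-- If `L p` lies in the ideal and `w` fixes `ker L` pointwise, then `w` acts on `p` by a scalar
modulo the ideal: apply `w` to an expression `L p = ∑ g i * f i`, subtract, and divide by `L`. -/
theorem mul_linForm_sub_polyAct_mem (hinv : ∀ i, f i ∈ invariants b W) {w : V ≃ₗᵢ[ℂ] V}
    (hw : w ∈ W) {L : Module.Dual ℂ V} (hL : L ≠ 0) (hfix : ∀ v, L v = 0 → w v = v) {ζ : ℂ}
    (hζ : dualAct w L = ζ • L) {p : MvPolynomial (Fin n) ℂ}
    (hp : linForm b L * p ∈ Ideal.span (Set.range f)) :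
    p - ζ • polyAct b w p ∈ Ideal.span (Set.range f) := by
  obtain ⟨g, hg⟩ := (Ideal.mem_span_range_iff_exists_fun).mp hp
  choose q hq using fun i => linForm_dvd_sub_polyAct b hfix (g i)
  refine Ideal.mem_span_range_iff_exists_fun.mpr ⟨q, ?_⟩
  refine mul_left_cancel₀ (prime_linForm b hL).ne_zero ?_
  have h1 : linForm b L * (ζ • polyAct b w p) = ∑ i, polyAct b w (g i) * f i := by
    rw [mul_smul_comm, ← smul_mul_assoc, ← map_smul, ← hζ, ← polyAct_linForm, ← map_mul, ← hg,
      map_sum]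
    exact Finset.sum_congr rfl fun i _ => by rw [map_mul, hinv i w hw]
  rw [mul_sub, h1, ← hg, ← Finset.sum_sub_distrib, Finset.mul_sum]
  exact Finset.sum_congr rfl fun i _ => by rw [← mul_assoc, ← hq, sub_mul]

/-- If the reflections act on `p` by the character `χ` modulo the ideal of the `f i`, then so does
the group that they generate. -/
theorem smul_sub_polyAct_mem (hW : IsFiniteReflectionGroup W) (hinv : ∀ i, f i ∈ invariants b W)
    (χ : W →* ℂ) {p : MvPolynomial (Fin n) ℂ}
    (hp : ∀ s : W, IsReflection (s : V ≃ₗᵢ[ℂ] V) →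
      χ s • p - polyAct b s p ∈ Ideal.span (Set.range f)) (w : W) :
    χ w • p - polyAct b w p ∈ Ideal.span (Set.range f) := by
  set I := Ideal.span (Set.range f)
  have hsmul : ∀ (c : ℂ) {q : MvPolynomial (Fin n) ℂ}, q ∈ I → c • q ∈ I := fun c q hq => by
    rw [smul_eq_C_mul]; exact Ideal.mul_mem_left _ _ hq
  have key : ∀ w, w ∈ Subgroup.closure {w | w ∈ W ∧ IsReflection w} →
      ∀ hw : w ∈ W, χ ⟨w, hw⟩ • p - polyAct b w p ∈ I := by
    intro w hw
    induction hw using Subgroup.closure_induction with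
    | mem x hx => exact fun hw => hp ⟨x, hw⟩ hx.2
    | one =>
      intro hw
      rw [polyAct_one, show (⟨1, hw⟩ : W) = 1 from rfl, map_one, one_smul, sub_self]
      exact zero_mem _
    | mul x y hx hy hx' hy' =>
      intro hw
      rw [hW.generated] at hx hy
      have e : χ ⟨x * y, hw⟩ • p - polyAct b (x * y) p =
          χ ⟨y, hy⟩ • (χ ⟨x, hx⟩ • p - polyAct b x p) +
            polyAct b x (χ ⟨y, hy⟩ • p - polyAct b y p) := by
        rw [show (⟨x * y, hw⟩ : W) = ⟨y, hy⟩ * (⟨y, hy⟩⁻¹ * ⟨x, hx⟩ * ⟨y, hy⟩) by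
          rw [mul_assoc, mul_inv_cancel_left]; rfl, map_mul, map_mul, map_mul, polyAct_mul,
          map_sub, map_smul, smul_sub, smul_smul]
        have h1 : χ ⟨y, hy⟩⁻¹ * χ ⟨y, hy⟩ = 1 := by rw [← map_mul, inv_mul_cancel, map_one]
        rw [mul_right_comm, h1, one_mul]
        abel
      rw [e]
      exact add_mem (hsmul _ (hx' hx)) (polyAct_mem_ideal b hinv hx (hy' hy))
    | inv x hx hx' =>
      intro hw
      rw [hW.generated] at hx
      have h1 : χ ⟨x⁻¹, hw⟩ * χ ⟨x, hx⟩ = 1 := by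
        rw [← map_mul, ← map_one χ]
        congr 1
        exact Subtype.ext (inv_mul_cancel x)
      have e : χ ⟨x⁻¹, hw⟩ • p - polyAct b x⁻¹ p =
          (-χ ⟨x⁻¹, hw⟩) • polyAct b x⁻¹ (χ ⟨x, hx⟩ • p - polyAct b x p) := by
        rw [map_sub, polyAct_inv_polyAct, map_smul, smul_sub, smul_smul, neg_mul, h1, neg_smul,
          neg_smul, one_smul]
        abel
      rw [e]
      exact hsmul _ (polyAct_mem_ideal b hinv hw (hx' hx))
  exact key w (hW.generated.symm ▸ w.2) w.2

end Ideal

/-! ### Integrality over the invariants -/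

section Orbit

variable {V : Type*} [NormedAddCommGroup V] [InnerProductSpace ℂ V] {n : ℕ}
  (b : OrthonormalBasis (Fin n) ℂ V) (W : Subgroup (V ≃ₗᵢ[ℂ] V)) [Fintype W]

open Classical in
/-- The orbit of `p` under `W`, without repetitions. -/
def polyOrbit (p : MvPolynomial (Fin n) ℂ) : Finset (MvPolynomial (Fin n) ℂ) :=
  Finset.univ.image fun w : W => polyAct b (w : V ≃ₗᵢ[ℂ] V) p

theorem self_mem_polyOrbit (p : MvPolynomial (Fin n) ℂ) : p ∈ polyOrbit b W p :=
  Finset.mem_image.mpr ⟨1, Finset.mem_univ _, polyAct_one b p⟩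

/-- The separable polynomial whose roots form the orbit of `p` under `W`. -/
def orbitPolynomial (p : MvPolynomial (Fin n) ℂ) : Polynomial (MvPolynomial (Fin n) ℂ) :=
  ∏ y ∈ polyOrbit b W p, (Polynomial.X - Polynomial.C y)

theorem coeff_orbitPolynomial_mem (p : MvPolynomial (Fin n) ℂ) (k : ℕ) :
    (orbitPolynomial b W p).coeff k ∈ invariants b W := by
  classical
  refine (mem_invariants b W).mpr fun w hw => ?_
  have h : (orbitPolynomial b W p).map (polyAct b w : _ →+* _) = orbitPolynomial b W p := by
    have hmem : ∀ w ∈ W, ∀ y ∈ polyOrbit b W p, polyAct b w y ∈ polyOrbit b W p := by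
      intro w hw y hy
      obtain ⟨u, _, rfl⟩ := Finset.mem_image.mp hy
      refine Finset.mem_image.mpr ⟨⟨w, hw⟩ * u, Finset.mem_univ _, ?_⟩
      rw [Subgroup.coe_mul, polyAct_mul]
    rw [orbitPolynomial, Polynomial.map_prod]
    refine Finset.prod_bij' (fun y _ => polyAct b w y) (fun y _ => polyAct b w⁻¹ y)
      (hmem w hw) (hmem _ (inv_mem hw)) (fun y _ => polyAct_inv_polyAct b w y)
      (fun y _ => ?_) (fun y _ => ?_)
    · rw [← polyAct_mul, mul_inv_cancel, polyAct_one]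
    · simp
  conv_rhs => rw [← h, Polynomial.coeff_map]
  rfl

theorem eval_orbitPolynomial (p : MvPolynomial (Fin n) ℂ) :
    (orbitPolynomial b W p).eval p = 0 := by
  rw [orbitPolynomial, Polynomial.eval_prod]
  exact Finset.prod_eq_zero (self_mem_polyOrbit b W p) (by simp)

theorem eval_derivative_orbitPolynomial_ne_zero (p : MvPolynomial (Fin n) ℂ) :
    (orbitPolynomial b W p).derivative.eval p ≠ 0 := by
  classical
  rw [orbitPolynomial, ← Finset.mul_prod_erase _ _ (self_mem_polyOrbit b W p),
    Polynomial.derivative_mul, Polynomial.eval_add, Polynomial.eval_mul, Polynomial.eval_mul,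
    Polynomial.eval_prod]
  simp only [Polynomial.derivative_sub, Polynomial.derivative_X, Polynomial.derivative_C, sub_zero,
    Polynomial.eval_one, one_mul, Polynomial.eval_sub, Polynomial.eval_X, Polynomial.eval_C,
    sub_self, zero_mul, add_zero]
  exact Finset.prod_ne_zero_iff.mpr fun y hy => sub_ne_zero.mpr (Finset.ne_of_mem_erase hy).symm

variable {W} {f : Fin n → MvPolynomial (Fin n) ℂ}

/-- Each `X j` is integral over the invariants, and the lower coefficients of its equation have no
constant term. -/
theorem X_mem_radical (hgen : Algebra.adjoin ℂ (Set.range f) = invariants b W)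
    (hf0 : ∀ i, constantCoeff (f i) = 0) (j : Fin n) :
    (X j : MvPolynomial (Fin n) ℂ) ∈ (Ideal.span (Set.range f)).radical := by
  classical
  set Q := orbitPolynomial b W (X j) with hQ
  have hmonic : Q.Monic := Polynomial.monic_prod_of_monic _ _ fun y _ => Polynomial.monic_X_sub_C y
  have h0 : Q.map (constantCoeff : MvPolynomial (Fin n) ℂ →+* ℂ) =
      Polynomial.X ^ (polyOrbit b W (X j)).card := by
    rw [hQ, orbitPolynomial, Polynomial.map_prod, ← Finset.prod_const]
    refine Finset.prod_congr rfl fun y hy => ?_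
    obtain ⟨u, _, rfl⟩ := Finset.mem_image.mp hy
    rw [Polynomial.map_sub, Polynomial.map_X, Polynomial.map_C, constantCoeff_polyAct,
      constantCoeff_X, map_zero, sub_zero]
  have hdeg : Q.natDegree = (polyOrbit b W (X j)).card := by
    have := congrArg Polynomial.natDegree h0
    rwa [hmonic.natDegree_map, Polynomial.natDegree_X_pow] at this
  have hcoeff : ∀ k < Q.natDegree, Q.coeff k ∈ Ideal.span (Set.range f) := fun k hk => by
    have h1 := sub_constantCoeff_mem b hgen hf0 (coeff_orbitPolynomial_mem b W (X j) k)
    have h2 := congrArg (fun P => Polynomial.coeff P k) h0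
    simp only [Polynomial.coeff_map, Polynomial.coeff_X_pow, if_neg (hdeg ▸ hk).ne] at h2
    rwa [h2, C_0, sub_zero] at h1
  refine ⟨Q.natDegree, ?_⟩
  have h3 := eval_orbitPolynomial b W (X j)
  rw [← hQ, Polynomial.eval_eq_sum_range, Finset.sum_range_succ, hmonic.coeff_natDegree, one_mul,
    add_comm] at h3
  rw [eq_neg_of_add_eq_zero_left h3]
  exact neg_mem (sum_mem fun k hk => Ideal.mul_mem_right _ _ (hcoeff k (Finset.mem_range.mp hk)))

theorem exists_pow_le_ideal (hgen : Algebra.adjoin ℂ (Set.range f) = invariants b W)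
    (hf0 : ∀ i, constantCoeff (f i) = 0) :
    ∃ N, (Ideal.span (Set.range (X : Fin n → MvPolynomial (Fin n) ℂ))) ^ N ≤
      Ideal.span (Set.range f) := by
  refine Ideal.exists_pow_le_of_le_radical_of_fg ?_ (IsNoetherian.noetherian _)
  rw [Ideal.span_le]
  rintro _ ⟨j, rfl⟩
  exact X_mem_radical b hgen hf0 j

end Orbit

/-! ### Steinberg's theorem on the annihilator of `Δ` -/

section Steinberg

variable {V : Type*} [NormedAddCommGroup V] [InnerProductSpace ℂ V] {n : ℕ}
  (b : OrthonormalBasis (Fin n) ℂ V) {W : Subgroup (V ≃ₗᵢ[ℂ] V)}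
  {L : Submodule ℂ V → Module.Dual ℂ V} {f : Fin n → MvPolynomial (Fin n) ℂ}

/-- For an invariant `r` without constant term, `r^* Δ` transforms like `Δ` but has smaller degree,
so it is not a nonzero multiple of `Δ`. -/
theorem starOp_delta_eq_zero (hW : IsFiniteReflectionGroup W)
    (hL : ∀ H ∈ reflectingHyperplanes W, LinearMap.ker (L H) = H) {r : MvPolynomial (Fin n) ℂ}
    (hr : r ∈ invariants b W) (hr0 : constantCoeff r = 0) : starOp r (delta b W L) = 0 := by
  have := hW.finite
  obtain ⟨χ, hχ⟩ := exists_delta_character b hW.finite hL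
  obtain ⟨q, -, hq⟩ := exists_eq_delta_mul b hW.finite hL hχ
    (q := starOp r (delta b W L)) fun w => by
      rw [← starOp_polyAct, hr w w.2, hχ, map_smul]
  by_contra hne
  have hlt := totalDegree_starOp_lt hr0 hne
  have hq0 : q ≠ 0 := fun h => hne (by rw [hq, h, mul_zero])
  rw [hq, totalDegree_mul_of_isDomain (delta_ne_zero b hW.finite hL) hq0] at hlt
  lia

theorem starOp_delta_eq_zero_of_mem (hW : IsFiniteReflectionGroup W)
    (hL : ∀ H ∈ reflectingHyperplanes W, LinearMap.ker (L H) = H)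
    (hinv : ∀ i, f i ∈ invariants b W) (hf0 : ∀ i, constantCoeff (f i) = 0)
    {p : MvPolynomial (Fin n) ℂ} (hp : p ∈ Ideal.span (Set.range f)) :
    starOp p (delta b W L) = 0 := by
  obtain ⟨g, rfl⟩ := Ideal.mem_span_range_iff_exists_fun.mp hp
  rw [starOp_sum, LinearMap.sum_apply]
  refine Finset.sum_eq_zero fun i _ => ?_
  rw [starOp_mul, Module.End.mul_apply, starOp_delta_eq_zero b hW hL (hinv i) (hf0 i), map_zero]

/-- Steinberg's theorem: the annihilator of `Δ` is the ideal generated by the invariants without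
constant term. By descending induction on the order of vanishing of `p` at `0`, the products
`L_H p` may be assumed to lie in the ideal; then `p` transforms like `Δ` modulo the ideal, so `p` is
congruent to a scalar multiple of `Δ`, and the scalar is zero because `⟨Δ, Δ⟩ ≠ 0`. -/
theorem mem_ideal_of_starOp_delta_eq_zero (hW : IsFiniteReflectionGroup W)
    (hL : ∀ H ∈ reflectingHyperplanes W, LinearMap.ker (L H) = H)
    (hgen : Algebra.adjoin ℂ (Set.range f) = invariants b W)
    (hf0 : ∀ i, constantCoeff (f i) = 0) {p : MvPolynomial (Fin n) ℂ}
    (hp : starOp p (delta b W L) = 0) : p ∈ Ideal.span (Set.range f) := by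
  have hfin := hW.finite
  have := Fintype.ofFinite W
  have hinv := mem_invariants_of_generate b hgen
  obtain ⟨χ, hχ⟩ := exists_delta_character b hW.finite hL
  obtain ⟨N, hN⟩ := exists_pow_le_ideal b hgen hf0
  set M := Ideal.span (Set.range (X : Fin n → MvPolynomial (Fin n) ℂ)) with hM
  set I := Ideal.span (Set.range f) with hI
  suffices key : ∀ e d, d + e = N → ∀ p ∈ M ^ d, starOp p (delta b W L) = 0 → p ∈ I from
    key N 0 (zero_add N) p (by rw [pow_zero, Ideal.one_eq_top]; trivial) hp
  intro e
  induction e with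
  | zero => exact fun d hd p hp _ => hN (by rwa [← hd, add_zero])
  | succ e ih =>
    intro d hd p hpd hp
    have hrefl : ∀ s : W, IsReflection (s : V ≃ₗᵢ[ℂ] V) → χ s • p - polyAct b s p ∈ I := by
      intro s hs
      have hH : fixedSpace (s : V ≃ₗᵢ[ℂ] V) ∈ reflectingHyperplanes W := ⟨s, s.2, hs, rfl⟩
      set H := fixedSpace (s : V ≃ₗᵢ[ℂ] V) with hHdef
      have hker := hL H hH
      have hfix : ∀ v, L H v = 0 → (s : V ≃ₗᵢ[ℂ] V) v = v := fun v hv => by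
        have : v ∈ H := hker ▸ hv
        exact this
      obtain ⟨ζ, hζ⟩ := exists_dualAct_eq_smul hfix
      have hLp : linForm b (L H) * p ∈ I := by
        refine ih (d + 1) (by lia) _ ?_ ?_
        · rw [pow_succ']
          refine Ideal.mul_mem_mul ?_ hpd
          rw [linForm_apply]
          exact sum_mem fun j _ => Ideal.mul_mem_left _ _ (Ideal.subset_span ⟨j, rfl⟩)
        · rw [starOp_mul, Module.End.mul_apply, hp, map_zero]
      have h1 := mul_linForm_sub_polyAct_mem b hinv s.2 (ne_zero_of_ker_eq hH hker) hfix hζ hLp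
      have h2 := delta_eigenvalue_mul b hfin hL hH (w := s) ⟨s.2, fun v hv => hv⟩ hζ (hχ s)
      have h3 := Ideal.mul_mem_left I (C (χ s)) h1
      rwa [← smul_eq_C_mul, smul_sub, smul_smul, h2, one_smul] at h3
    have hall := smul_sub_polyAct_mem b hW hinv χ hrefl
    have hχinv : ∀ w : W, χ w⁻¹ * χ w = 1 := fun w => by
      rw [← map_mul, inv_mul_cancel, map_one]
    obtain ⟨r, hr, hpr⟩ := exists_eq_delta_mul b hfin hL hχ
      (q := ∑ w : W, χ w⁻¹ • polyAct b (w : V ≃ₗᵢ[ℂ] V) p) fun u => by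
        rw [map_sum, Finset.smul_sum]
        refine Fintype.sum_equiv (Equiv.mulLeft u) _ _ fun w => ?_
        rw [map_smul, smul_smul, ← polyAct_mul, Equiv.coe_mulLeft, mul_inv_rev, map_mul,
          mul_comm (χ w⁻¹), ← mul_assoc, mul_comm (χ u), hχinv, one_mul]
        rfl
    have h1 : (Fintype.card W : ℂ) • p - ∑ w : W, χ w⁻¹ • polyAct b (w : V ≃ₗᵢ[ℂ] V) p ∈ I := by
      have e : (Fintype.card W : ℂ) • p - ∑ w : W, χ w⁻¹ • polyAct b (w : V ≃ₗᵢ[ℂ] V) p =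
          ∑ w : W, C (χ w⁻¹) * (χ w • p - polyAct b (w : V ≃ₗᵢ[ℂ] V) p) := by
        simp_rw [← smul_eq_C_mul, smul_sub, smul_smul, hχinv, one_smul, Finset.sum_sub_distrib]
        simp [Nat.cast_smul_eq_nsmul]
      rw [e]
      exact sum_mem fun w _ => Ideal.mul_mem_left _ _ (hall w)
    set c := constantCoeff r with hc
    have h2 : (Fintype.card W : ℂ) • p - c • delta b W L ∈ I := by
      have e : (Fintype.card W : ℂ) • p - c • delta b W L =
          ((Fintype.card W : ℂ) • p - ∑ w : W, χ w⁻¹ • polyAct b (w : V ≃ₗᵢ[ℂ] V) p) +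
            delta b W L * (r - C c) := by
        rw [hpr, smul_eq_C_mul (delta b W L)]; ring
      rw [e]
      exact add_mem h1 (Ideal.mul_mem_left _ _ (sub_constantCoeff_mem b hgen hf0 hr))
    have h3 := starOp_delta_eq_zero_of_mem b hW hL hinv hf0 h2
    rw [starOp_sub, starOp_smul, starOp_smul, LinearMap.sub_apply, LinearMap.smul_apply,
      LinearMap.smul_apply, hp, smul_zero, zero_sub, neg_eq_zero] at h3
    have hc0 : c = 0 := by
      rcases smul_eq_zero.mp h3 with h | h
      · exact (map_eq_zero _).mp h
      · refine absurd (eq_zero_of_pairing_self ?_) (delta_ne_zero b hfin hL)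
        rw [pairing_apply, h, map_zero]
    rw [hc0, zero_smul, sub_zero] at h2
    have hcard : (Fintype.card W : ℂ) ≠ 0 := by exact_mod_cast Fintype.card_ne_zero
    have h4 := Ideal.mul_mem_left I (C (Fintype.card W : ℂ)⁻¹) h2
    rwa [← smul_eq_C_mul, smul_smul, inv_mul_cancel₀ hcard, one_smul] at h4

end Steinberg
/-! ### Harmonic polynomials -/

section Harmonic

variable {V : Type*} [NormedAddCommGroup V] [InnerProductSpace ℂ V] {n : ℕ}
  (b : OrthonormalBasis (Fin n) ℂ V) {W : Subgroup (V ≃ₗᵢ[ℂ] V)}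
  {L : Submodule ℂ V → Module.Dual ℂ V} {f : Fin n → MvPolynomial (Fin n) ℂ}

/-- The polynomials that are annihilated by the operators `(f i)^*`. -/
def harmonicSpace (f : Fin n → MvPolynomial (Fin n) ℂ) : Submodule ℂ (MvPolynomial (Fin n) ℂ) :=
  ⨅ i, LinearMap.ker (starOp (f i))

theorem mem_harmonicSpace {p : MvPolynomial (Fin n) ℂ} :
    p ∈ harmonicSpace f ↔ ∀ i, starOp (f i) p = 0 := by
  simp [harmonicSpace]

theorem starOp_eq_zero_of_mem_ideal {p q : MvPolynomial (Fin n) ℂ} (hp : p ∈ harmonicSpace f)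
    (hq : q ∈ Ideal.span (Set.range f)) : starOp q p = 0 := by
  obtain ⟨g, rfl⟩ := Ideal.mem_span_range_iff_exists_fun.mp hq
  rw [starOp_sum, LinearMap.sum_apply]
  refine Finset.sum_eq_zero fun i _ => ?_
  rw [starOp_mul, Module.End.mul_apply, mem_harmonicSpace.mp hp i, map_zero]

theorem eq_zero_of_mem_ideal_of_mem_harmonicSpace {p : MvPolynomial (Fin n) ℂ}
    (hI : p ∈ Ideal.span (Set.range f)) (hp : p ∈ harmonicSpace f) : p = 0 :=
  eq_zero_of_pairing_self (by
    rw [pairing_apply, starOp_eq_zero_of_mem_ideal hp hI, map_zero])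

theorem finiteDimensional_derivativeSpace (P : MvPolynomial (Fin n) ℂ) :
    FiniteDimensional ℂ (derivativeSpace P) := by
  refine Submodule.finiteDimensional_of_le (S₂ := restrictTotalDegree (Fin n) ℂ P.totalDegree) ?_
  rintro _ ⟨g, rfl⟩
  rw [mem_restrictTotalDegree]
  exact totalDegree_starOp_le g P

/-- Orthogonal decomposition with respect to a finite-dimensional space of polynomials. -/
theorem exists_pairing_sub_eq_zero (M : Submodule ℂ (MvPolynomial (Fin n) ℂ))
    [FiniteDimensional ℂ M] (p : MvPolynomial (Fin n) ℂ) :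
    ∃ h ∈ M, ∀ g ∈ M, pairing g (p - h) = 0 := by
  let e := Module.finBasis ℂ M
  have hspan : ∀ q, (∀ k, pairing (e k : MvPolynomial (Fin n) ℂ) q = 0) →
      ∀ g ∈ M, pairing g q = 0 := by
    intro q hq g hg
    have h1 := congrArg (Subtype.val) (e.sum_repr ⟨g, hg⟩)
    rw [Submodule.coe_sum] at h1
    change _ = g at h1
    rw [← h1, pairing_sum_left]
    refine Finset.sum_eq_zero fun k _ => ?_
    rw [Submodule.coe_smul, pairing_apply, starOp_smul, LinearMap.smul_apply, smul_eq_C_mul,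
      map_mul, ← pairing_apply, hq, mul_zero]
  let T : M →ₗ[ℂ] (Fin (Module.finrank ℂ M) → ℂ) :=
    LinearMap.pi fun k => pairing (e k : MvPolynomial (Fin n) ℂ) ∘ₗ M.subtype
  have hT : Function.Injective T := by
    rw [← LinearMap.ker_eq_bot, LinearMap.ker_eq_bot']
    intro m hm
    exact Subtype.ext (eq_zero_of_pairing_self (hspan m (fun k => congrFun hm k) m m.2))
  have hsurj : Function.Surjective T :=
    (LinearMap.injective_iff_surjective_of_finrank_eq_finrank (by simp)).mp hT
  obtain ⟨h, hh⟩ := hsurj fun k => pairing (e k : MvPolynomial (Fin n) ℂ) p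
  refine ⟨h, h.2, hspan _ fun k => ?_⟩
  rw [map_sub, sub_eq_zero]
  exact (congrFun hh k).symm

/-- The derivatives of `Δ` are exactly the harmonic polynomials: a harmonic polynomial that is
orthogonal to all `g^* Δ` annihilates `Δ`, so it lies in the ideal of the `f i`, to which the
harmonic polynomials are orthogonal. -/
theorem harmonics_eq_harmonicSpace (hW : IsFiniteReflectionGroup W)
    (hL : ∀ H ∈ reflectingHyperplanes W, LinearMap.ker (L H) = H)
    (hgen : Algebra.adjoin ℂ (Set.range f) = invariants b W)
    (hf0 : ∀ i, constantCoeff (f i) = 0) : harmonics b W L = harmonicSpace f := by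
  have hle : harmonics b W L ≤ harmonicSpace f := by
    rintro _ ⟨g, rfl⟩
    refine mem_harmonicSpace.mpr fun i => ?_
    rw [starOp_comm_apply,
      starOp_delta_eq_zero b hW hL (mem_invariants_of_generate b hgen i) (hf0 i), map_zero]
  refine le_antisymm hle fun p hp => ?_
  have : FiniteDimensional ℂ (harmonics b W L) := finiteDimensional_derivativeSpace _
  obtain ⟨h, hh, horth⟩ := exists_pairing_sub_eq_zero (harmonics b W L) p
  have hann : starOp (p - h) (delta b W L) = 0 := by
    refine eq_zero_of_pairing_self ?_
    set q := starOp (p - h) (delta b W L) with hq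
    have h1 : pairing (starOp q (delta b W L)) (p - h) = 0 := horth _ ⟨q, rfl⟩
    rw [← pairing_conj_symm, map_eq_zero, pairing_apply, starOp_comm_apply, ← pairing_apply] at h1
    exact h1
  have h2 := mem_ideal_of_starOp_delta_eq_zero b hW hL hgen hf0 hann
  have h3 := eq_zero_of_mem_ideal_of_mem_harmonicSpace h2 (sub_mem hp (hle hh))
  rw [sub_eq_zero.mp h3]
  exact hh

end Harmonic

/-! ### Chevalley's lemma and independence over the harmonic polynomials -/

section Chevalley

variable {V : Type*} [NormedAddCommGroup V] [InnerProductSpace ℂ V] {n : ℕ}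
  (b : OrthonormalBasis (Fin n) ℂ V) {W : Subgroup (V ≃ₗᵢ[ℂ] V)}
  {L : Submodule ℂ V → Module.Dual ℂ V} {f : Fin n → MvPolynomial (Fin n) ℂ}

/-- Chevalley's lemma: if in every relation `∑ r a * u a = 0` with invariant `u` the coefficient
`u a₀` has no constant term, then in every relation `∑ r a * p a = 0` the coefficient `p a₀` lies in
the ideal of the `f i`. The proof is by induction on the degree of `p a₀`, with the relations
obtained from the quotients `(p a - s p a) / L_s`. -/
theorem mem_ideal_of_sum_mul_eq_zero (hW : IsFiniteReflectionGroup W)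
    (hL : ∀ H ∈ reflectingHyperplanes W, LinearMap.ker (L H) = H)
    (hgen : Algebra.adjoin ℂ (Set.range f) = invariants b W)
    (hf0 : ∀ i, constantCoeff (f i) = 0) {ι : Type*} (T : Finset ι)
    {r : ι → MvPolynomial (Fin n) ℂ} (hr : ∀ a, r a ∈ invariants b W) (a₀ : ι)
    (hmin : ∀ u : ι → MvPolynomial (Fin n) ℂ, (∀ a, u a ∈ invariants b W) →
      ∑ a ∈ T, r a * u a = 0 → constantCoeff (u a₀) = 0)
    (p : ι → MvPolynomial (Fin n) ℂ) (hp : ∑ a ∈ T, r a * p a = 0) :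
    p a₀ ∈ Ideal.span (Set.range f) := by
  have hfin := hW.finite
  have := Fintype.ofFinite W
  have hinv := mem_invariants_of_generate b hgen
  set I := Ideal.span (Set.range f) with hI
  suffices key : ∀ d, ∀ p : ι → MvPolynomial (Fin n) ℂ, (p a₀).totalDegree < d →
      ∑ a ∈ T, r a * p a = 0 → p a₀ ∈ I from key _ p (Nat.lt_succ_self _) hp
  intro d
  induction d with
  | zero => exact fun p hd => absurd hd (Nat.not_lt_zero _)
  | succ d ih =>
    intro p hd hp
    have hrefl : ∀ s : W, IsReflection (s : V ≃ₗᵢ[ℂ] V) →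
        (1 : W →* ℂ) s • p a₀ - polyAct b s (p a₀) ∈ I := by
      intro s hs
      rw [MonoidHom.one_apply, one_smul]
      have hH : fixedSpace (s : V ≃ₗᵢ[ℂ] V) ∈ reflectingHyperplanes W := ⟨s, s.2, hs, rfl⟩
      obtain ⟨M, hM⟩ : ∃ M : Module.Dual ℂ V,
          LinearMap.ker M = fixedSpace (s : V ≃ₗᵢ[ℂ] V) := ⟨_, hL _ hH⟩
      have hM0 : M ≠ 0 := ne_zero_of_ker_eq hH hM
      have hfix : ∀ v, M v = 0 → (s : V ≃ₗᵢ[ℂ] V) v = v := fun v hv => by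
        have : v ∈ fixedSpace (s : V ≃ₗᵢ[ℂ] V) := hM ▸ hv
        exact this
      have hprime := prime_linForm b hM0
      choose q hq using fun a => linForm_dvd_sub_polyAct b hfix (p a)
      have hq0 : ∑ a ∈ T, r a * q a = 0 := by
        refine mul_left_cancel₀ hprime.ne_zero ?_
        have h1 : ∑ a ∈ T, r a * polyAct b s (p a) = 0 := by
          rw [← map_zero (polyAct b (s : V ≃ₗᵢ[ℂ] V)), ← hp, map_sum]
          exact Finset.sum_congr rfl fun a _ => by rw [map_mul, hr a s s.2]
        have h2 := congrArg₂ (· - ·) hp h1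
        simp only [← Finset.sum_sub_distrib, ← mul_sub, hq, sub_zero] at h2
        rw [mul_zero, ← h2, Finset.mul_sum]
        exact Finset.sum_congr rfl fun a _ => mul_left_comm _ _ _
      rw [hq]
      refine Ideal.mul_mem_left _ _ ?_
      by_cases hqa : q a₀ = 0
      · rw [hqa]; exact zero_mem _
      refine ih q ?_ hq0
      have h2 := totalDegree_mul_of_isDomain hprime.ne_zero hqa
      rw [← hq, (isHomogeneous_linForm b M).totalDegree hprime.ne_zero] at h2
      have h3 := totalDegree_sub (p a₀) (polyAct b s (p a₀))
      rw [max_eq_left (totalDegree_polyAct_le b _ _)] at h3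
      lia
    have hall := smul_sub_polyAct_mem b hW hinv 1 hrefl
    have h1 : (Fintype.card W : ℂ) • p a₀ - orbitSum b W (p a₀) ∈ I := by
      have e : (Fintype.card W : ℂ) • p a₀ - orbitSum b W (p a₀) =
          ∑ w : W, ((1 : W →* ℂ) w • p a₀ - polyAct b (w : V ≃ₗᵢ[ℂ] V) (p a₀)) := by
        simp_rw [MonoidHom.one_apply, one_smul, Finset.sum_sub_distrib, ← orbitSum_apply]
        simp [Nat.cast_smul_eq_nsmul]
      rw [e]
      exact sum_mem fun w _ => hall w
    have h2 : orbitSum b W (p a₀) ∈ I := by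
      have h3 := sub_constantCoeff_mem b hgen hf0 (orbitSum_mem b (W := W) (p a₀))
      rwa [hmin (fun a => orbitSum b W (p a)) (fun a => orbitSum_mem b (p a)) (by
        rw [← map_zero (orbitSum b W), ← hp, map_sum]
        exact Finset.sum_congr rfl fun a _ => (orbitSum_mul b (hr a) (p a)).symm), C_0,
        sub_zero] at h3
    have hcard : (Fintype.card W : ℂ) ≠ 0 := by exact_mod_cast Fintype.card_ne_zero
    have h4 := Ideal.mul_mem_left I (C (Fintype.card W : ℂ)⁻¹) (add_mem h1 h2)
    rwa [sub_add_cancel, ← smul_eq_C_mul, smul_smul, inv_mul_cancel₀ hcard, one_smul] at h4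

theorem constantCoeff_aeval (hf0 : ∀ i, constantCoeff (f i) = 0)
    (γ : MvPolynomial (Fin n) ℂ) : constantCoeff (aeval f γ) = constantCoeff γ := by
  induction γ using MvPolynomial.induction_on with
  | C a => rw [aeval_C, algebraMap_eq]
  | add p q hp hq => rw [map_add, map_add, map_add, hp, hq]
  | mul_X p j hp =>
    rw [map_mul, map_mul, map_mul, aeval_X, hf0, constantCoeff_X, mul_zero, mul_zero]

theorem exists_aeval_eq (hgen : Algebra.adjoin ℂ (Set.range f) = invariants b W)
    {r : MvPolynomial (Fin n) ℂ} (hr : r ∈ invariants b W) :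
    ∃ γ : MvPolynomial (Fin n) ℂ, aeval f γ = r := by
  rw [← hgen, Algebra.adjoin_range_eq_range_aeval] at hr
  exact hr

theorem aeval_mem_invariants (hgen : Algebra.adjoin ℂ (Set.range f) = invariants b W)
    (γ : MvPolynomial (Fin n) ℂ) : aeval f γ ∈ invariants b W := by
  rw [← hgen, Algebra.adjoin_range_eq_range_aeval]
  exact ⟨γ, rfl⟩

/-- The monomials in the basic invariants are linearly independent over the harmonic
polynomials. -/
theorem eq_zero_of_sum_aeval_monomial_mul (hW : IsFiniteReflectionGroup W)
    (hL : ∀ H ∈ reflectingHyperplanes W, LinearMap.ker (L H) = H)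
    (hgen : Algebra.adjoin ℂ (Set.range f) = invariants b W)
    (hf0 : ∀ i, constantCoeff (f i) = 0) (hind : AlgebraicIndependent ℂ f)
    (T : Finset (Fin n →₀ ℕ)) (h : (Fin n →₀ ℕ) → MvPolynomial (Fin n) ℂ)
    (hh : ∀ a, h a ∈ harmonicSpace f)
    (hsum : ∑ a ∈ T, aeval f (monomial a (1 : ℂ)) * h a = 0) : ∀ a ∈ T, h a = 0 := by
  classical
  by_contra! hne
  obtain ⟨a₁, ha₁, hne₁⟩ := hne
  -- An exponent that is minimal among the coefficients that occur.
  obtain ⟨a₀, ha₀⟩ := (T.filter fun a => h a ≠ 0).exists_minimal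
    ⟨a₁, Finset.mem_filter.mpr ⟨ha₁, hne₁⟩⟩
  have hsum' : ∑ a ∈ T.filter (fun a => h a ≠ 0), aeval f (monomial a (1 : ℂ)) * h a = 0 := by
    refine (Finset.sum_subset (Finset.filter_subset _ _) fun a haT ha => ?_).trans hsum
    have : h a = 0 := by
      by_contra hc
      exact ha (Finset.mem_filter.mpr ⟨haT, hc⟩)
    rw [this, mul_zero]
  refine (Finset.mem_filter.mp ha₀.prop).2 (eq_zero_of_mem_ideal_of_mem_harmonicSpace
    (mem_ideal_of_sum_mul_eq_zero b hW hL hgen hf0 _ (fun a => aeval_mem_invariants b hgen _) a₀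
      (fun u hu hrel => ?_) h hsum') (hh a₀))
  choose υ hυ using fun a => exists_aeval_eq b hgen (hu a)
  have h1 : ∑ a ∈ T.filter (fun a => h a ≠ 0), monomial a (1 : ℂ) * υ a = 0 := by
    refine hind ?_
    rw [map_sum, map_zero]
    exact (Finset.sum_congr rfl fun a _ => by rw [map_mul, hυ]).trans hrel
  have h2 := congrArg (coeff a₀) h1
  rw [coeff_sum, Finset.sum_eq_single a₀, coeff_monomial_mul', if_pos le_rfl, tsub_self, one_mul,
    coeff_zero] at h2
  · rw [← hυ, constantCoeff_aeval hf0]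
    exact h2
  · intro a ha hne
    rw [coeff_monomial_mul', if_neg fun hle => hne (le_antisymm hle (ha₀.le_of_le ha hle))]
  · exact fun h => absurd ha₀.prop h

end Chevalley
/-! ### Invariant tuples and gradients of the basic invariants -/

section Gradients

variable {V : Type*} [NormedAddCommGroup V] [InnerProductSpace ℂ V] {n : ℕ}
  (b : OrthonormalBasis (Fin n) ℂ V) {W : Subgroup (V ≃ₗᵢ[ℂ] V)}
  {L : Submodule ℂ V → Module.Dual ℂ V} {f : Fin n → MvPolynomial (Fin n) ℂ}

/-- Chain rule for a polynomial in the `f i`. -/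
theorem pderiv_aeval (γ : MvPolynomial (Fin n) ℂ) (k : Fin n) :
    pderiv k (aeval f γ) = ∑ i, aeval f (pderiv i γ) * pderiv k (f i) := by
  classical
  induction γ using MvPolynomial.induction_on with
  | C a => simp [← algebraMap_eq]
  | add p q hp hq => simp only [map_add, add_mul, Finset.sum_add_distrib, hp, hq]
  | mul_X p j hp =>
    have e : ∀ i, aeval f (pderiv i (p * X j)) * pderiv k (f i) =
        aeval f (pderiv i p) * pderiv k (f i) * f j +
          aeval f p * (aeval f (pderiv i (X j : MvPolynomial (Fin n) ℂ)) * pderiv k (f i)) := by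
      intro i
      rw [pderiv_mul, map_add, map_mul, map_mul, aeval_X]
      ring
    rw [Finset.sum_congr rfl fun i _ => e i, Finset.sum_add_distrib, ← Finset.sum_mul, ← hp,
      ← Finset.mul_sum, map_mul, aeval_X, pderiv_mul]
    congr 2
    rw [Finset.sum_eq_single j]
    · rw [pderiv_X_self, map_one, one_mul]
    · intro i _ hi
      rw [pderiv_X_of_ne hi.symm, map_zero, zero_mul]
    · simp

theorem exists_pderiv_eval_eq (hgen : Algebra.adjoin ℂ (Set.range f) = invariants b W)
    (P : Polynomial (MvPolynomial (Fin n) ℂ)) (hP : ∀ m, P.coeff m ∈ invariants b W)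
    (y : MvPolynomial (Fin n) ℂ) :
    ∃ g : Fin n → MvPolynomial (Fin n) ℂ, ∀ k, pderiv k (P.eval y) =
      ∑ i, g i * pderiv k (f i) + P.derivative.eval y * pderiv k y := by
  choose γ hγ using fun m => exists_aeval_eq b hgen (hP m)
  have hterm : ∀ m k, pderiv k ((Polynomial.monomial m (P.coeff m)).eval y) =
      ∑ i, y ^ m * aeval f (pderiv i (γ m)) * pderiv k (f i) +
        (Polynomial.derivative (Polynomial.monomial m (P.coeff m))).eval y * pderiv k y := by
    intro m k
    rw [Polynomial.eval_monomial, pderiv_mul, pderiv_pow, Polynomial.derivative_monomial,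
      Polynomial.eval_monomial]
    nth_rw 1 [← hγ m]
    rw [pderiv_aeval, Finset.sum_mul]
    refine congr (congrArg HAdd.hAdd ?_) ?_
    · exact Finset.sum_congr rfl fun i _ => by ring
    · ring
  refine ⟨fun i => ∑ m ∈ Finset.range (P.natDegree + 1), y ^ m * aeval f (pderiv i (γ m)),
    fun k => ?_⟩
  conv_lhs => rw [P.as_sum_range]
  conv_rhs => enter [2]; rw [P.as_sum_range]
  rw [Polynomial.eval_finsetSum, map_sum, Polynomial.derivative_sum, Polynomial.eval_finsetSum,
    Finset.sum_mul, Finset.sum_congr rfl fun m _ => hterm m k, Finset.sum_add_distrib,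
    Finset.sum_comm]
  congr 1
  exact Finset.sum_congr rfl fun i _ => by rw [Finset.sum_mul]

/-- The gradients of the basic invariants generate `S^n` up to a denominator: differentiate the
separable equation of each `X j` over the invariants. -/
theorem exists_mul_eq_sum_gradient [Fintype W]
    (hgen : Algebra.adjoin ℂ (Set.range f) = invariants b W) :
    ∃ D : MvPolynomial (Fin n) ℂ, D ≠ 0 ∧ ∀ h : Fin n → MvPolynomial (Fin n) ℂ,
      ∃ g : Fin n → MvPolynomial (Fin n) ℂ, ∀ k, D * h k = ∑ i, g i * pderiv k (f i) := by
  classical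
  set E : Fin n → MvPolynomial (Fin n) ℂ :=
    fun j => (orbitPolynomial b W (X j)).derivative.eval (X j) with hE
  have hrel : ∀ j, ∃ g : Fin n → MvPolynomial (Fin n) ℂ, ∀ k,
      E j * pderiv k (X j) = ∑ i, g i * pderiv k (f i) := by
    intro j
    obtain ⟨g, hg⟩ := exists_pderiv_eval_eq b hgen (orbitPolynomial b W (X j))
      (coeff_orbitPolynomial_mem b W (X j)) (X j)
    refine ⟨fun i => -g i, fun k => ?_⟩
    have h1 := hg k
    rw [eval_orbitPolynomial, map_zero] at h1
    simp only [neg_mul, Finset.sum_neg_distrib]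
    exact eq_neg_of_add_eq_zero_right h1.symm
  choose g hg using hrel
  refine ⟨∏ j, E j, Finset.prod_ne_zero_iff.mpr fun j _ =>
    eval_derivative_orbitPolynomial_ne_zero b W (X j), fun h =>
    ⟨fun i => ∑ j, (∏ l ∈ Finset.univ.erase j, E l) * h j * g j i, fun k => ?_⟩⟩
  simp_rw [Finset.sum_mul]
  rw [Finset.sum_comm]
  have h1 : ∀ j, ∑ i, (∏ l ∈ Finset.univ.erase j, E l) * h j * g j i * pderiv k (f i) =
      (∏ l, E l) * (h j * pderiv k (X j)) := by
    intro j
    rw [← Finset.mul_prod_erase Finset.univ E (Finset.mem_univ j)]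
    have e : E j * (∏ l ∈ Finset.univ.erase j, E l) * (h j * pderiv k (X j)) =
        (∏ l ∈ Finset.univ.erase j, E l) * h j * (E j * pderiv k (X j)) := by ring
    rw [e, hg, Finset.mul_sum]
    exact Finset.sum_congr rfl fun i _ => by ring
  rw [Finset.sum_congr rfl fun j _ => h1 j, ← Finset.mul_sum, Finset.sum_eq_single k]
  · rw [pderiv_X_self, mul_one]
  · intro j _ hj
    rw [pderiv_X_of_ne hj, mul_zero]
  · simp

/-- The tuple of coefficients of a `W`-invariant element of `S ⊗ V^*`. -/
def IsInvariantTuple (W : Subgroup (V ≃ₗᵢ[ℂ] V)) (h : Fin n → MvPolynomial (Fin n) ℂ) : Prop :=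
  ∀ w ∈ W, ∀ k, ∑ j, C (dualAct w (b.toBasis.coord j) (b k)) * polyAct b w (h j) = h k

theorem isInvariantTuple_pderiv {p : MvPolynomial (Fin n) ℂ} (hp : p ∈ invariants b W) :
    IsInvariantTuple b W fun j => pderiv j p := fun w hw k => by
  rw [← pderiv_polyAct, hp w hw]

/-- Averaging over `W` makes the denominator and the coefficients invariant. -/
theorem exists_invariant_mul_eq_sum_gradient (hfin : Finite W)
    (hgen : Algebra.adjoin ℂ (Set.range f) = invariants b W)
    {h : Fin n → MvPolynomial (Fin n) ℂ} (hh : IsInvariantTuple b W h) :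
    ∃ r ∈ invariants b W, r ≠ 0 ∧ ∃ q : Fin n → MvPolynomial (Fin n) ℂ,
      (∀ i, q i ∈ invariants b W) ∧ ∀ k, r * h k = ∑ i, q i * pderiv k (f i) := by
  classical
  have := Fintype.ofFinite W
  obtain ⟨D, hD, hDh⟩ := exists_mul_eq_sum_gradient b hgen
  obtain ⟨g, hg⟩ := hDh h
  -- The norm of `D` is an invariant multiple of `D`.
  set N := ∏ w : W, polyAct b (w : V ≃ₗᵢ[ℂ] V) D with hN
  have hN0 : N ≠ 0 := Finset.prod_ne_zero_iff.mpr fun w _ =>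
    (map_ne_zero_iff _ (polyAct_injective b _)).mpr hD
  have hNinv : N ∈ invariants b W := by
    refine (mem_invariants b W).mpr fun w hw => ?_
    rw [hN, map_prod]
    refine Fintype.prod_equiv (Equiv.mulLeft ⟨w, hw⟩) _ _ fun u => ?_
    rw [Equiv.coe_mulLeft, Subgroup.coe_mul, polyAct_mul]
  obtain ⟨p, hp⟩ : D ∣ N := by
    have h1 := Finset.dvd_prod_of_mem (fun w : W => polyAct b (w : V ≃ₗᵢ[ℂ] V) D)
      (Finset.mem_univ 1)
    rwa [Subgroup.coe_one, polyAct_one] at h1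
  have hNg : ∀ k, N * h k = ∑ i, p * g i * pderiv k (f i) := fun k => by
    rw [hp, mul_comm D, mul_assoc, hg, Finset.mul_sum]
    exact Finset.sum_congr rfl fun i _ => (mul_assoc _ _ _).symm
  have hinv := mem_invariants_of_generate b hgen
  have hw : ∀ (w : W) k, N * h k = ∑ i, polyAct b w (p * g i) * pderiv k (f i) := by
    intro w k
    rw [← hh w w.2 k, Finset.mul_sum]
    have h1 : ∀ j, N * (C (dualAct (w : V ≃ₗᵢ[ℂ] V) (b.toBasis.coord j) (b k)) *
        polyAct b w (h j)) = ∑ i, polyAct b w (p * g i) *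
          (C (dualAct (w : V ≃ₗᵢ[ℂ] V) (b.toBasis.coord j) (b k)) *
            polyAct b w (pderiv j (f i))) := by
      intro j
      rw [mul_left_comm]
      nth_rw 1 [← hNinv w w.2]
      rw [← map_mul, hNg, map_sum, Finset.mul_sum]
      exact Finset.sum_congr rfl fun i _ => by rw [map_mul, mul_left_comm]
    rw [Finset.sum_congr rfl fun j _ => h1 j, Finset.sum_comm]
    refine Finset.sum_congr rfl fun i _ => ?_
    rw [← Finset.mul_sum, isInvariantTuple_pderiv b (hinv i) w w.2 k]
  have hcard : (C (Fintype.card W : ℂ) : MvPolynomial (Fin n) ℂ) ≠ 0 := by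
    rw [Ne, C_eq_zero]
    exact_mod_cast Fintype.card_ne_zero
  refine ⟨C (Fintype.card W : ℂ) * N, mul_mem (Subalgebra.algebraMap_mem _ _) hNinv,
    mul_ne_zero hcard hN0, fun i => orbitSum b W (p * g i), fun i => orbitSum_mem b _,
    fun k => ?_⟩
  simp_rw [orbitSum_apply, Finset.sum_mul]
  rw [Finset.sum_comm, ← Finset.sum_congr rfl fun w _ => hw w k, Finset.sum_const,
    Finset.card_univ, nsmul_eq_mul, map_natCast, mul_assoc]

theorem pderiv_mem_harmonicSpace (horth : ∀ i j, starOp (f i) (f j) = if i = j then 1 else 0)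
    (i k : Fin n) : pderiv k (f i) ∈ harmonicSpace f := by
  refine mem_harmonicSpace.mpr fun j => ?_
  rw [← starOp_X, starOp_comm_apply, horth, starOp_X]
  split_ifs
  · exact pderiv_one
  · exact map_zero _

/-- An invariant tuple of harmonic polynomials is a linear combination, with constant coefficients,
of the gradients of a canonical system: compare the coefficients of the monomials in the `f i` in a
relation `r h = ∑ q i • ∇ (f i)` with invariant `r ≠ 0` and `q i`. -/
theorem exists_eq_sum_smul_gradient (hW : IsFiniteReflectionGroup W)
    (hL : ∀ H ∈ reflectingHyperplanes W, LinearMap.ker (L H) = H)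
    (hgen : Algebra.adjoin ℂ (Set.range f) = invariants b W)
    (hf0 : ∀ i, constantCoeff (f i) = 0) (hind : AlgebraicIndependent ℂ f)
    (horth : ∀ i j, starOp (f i) (f j) = if i = j then 1 else 0)
    {h : Fin n → MvPolynomial (Fin n) ℂ} (hh : IsInvariantTuple b W h)
    (hharm : ∀ k, h k ∈ harmonicSpace f) :
    ∃ c : Fin n → ℂ, ∀ k, h k = ∑ i, c i • pderiv k (f i) := by
  classical
  obtain ⟨r, hr, hr0, q, hq, hrel⟩ := exists_invariant_mul_eq_sum_gradient b hW.finite hgen hh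
  obtain ⟨ρ, rfl⟩ := exists_aeval_eq b hgen hr
  choose κ hκ using fun i => exists_aeval_eq b hgen (hq i)
  have hexp : ∀ (T : Finset (Fin n →₀ ℕ)) (γ : MvPolynomial (Fin n) ℂ), γ.support ⊆ T →
      aeval f γ = ∑ a ∈ T, C (coeff a γ) * aeval f (monomial a (1 : ℂ)) := by
    intro T γ hT
    conv_lhs => rw [γ.as_sum, map_sum]
    refine (Finset.sum_congr rfl fun a _ => ?_).trans (Finset.sum_subset hT fun a _ ha => ?_)
    · rw [← smul_eq_C_mul, ← map_smul, smul_monomial, smul_eq_mul, mul_one]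
    · rw [notMem_support_iff.mp ha, C_0, zero_mul]
  obtain ⟨a₀, ha₀⟩ := support_nonempty.mpr (show ρ ≠ 0 from fun h0 => hr0 (by rw [h0, map_zero]))
  set T := ρ.support ∪ Finset.univ.biUnion fun i => (κ i).support with hT
  have hκT : ∀ i, (κ i).support ⊆ T := fun i =>
    (Finset.subset_biUnion_of_mem (fun i => (κ i).support) (Finset.mem_univ i)).trans
      Finset.subset_union_right
  have hcoef : ∀ k, C (coeff a₀ ρ) * h k - ∑ i, C (coeff a₀ (κ i)) * pderiv k (f i) = 0 := by
    intro k
    refine eq_zero_of_sum_aeval_monomial_mul b hW hL hgen hf0 hind T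
      (fun a => C (coeff a ρ) * h k - ∑ i, C (coeff a (κ i)) * pderiv k (f i)) (fun a => ?_) ?_ a₀
      (Finset.subset_union_left ha₀)
    · refine sub_mem ?_ (sum_mem fun i _ => ?_)
      · rw [← smul_eq_C_mul]
        exact Submodule.smul_mem _ _ (hharm k)
      · rw [← smul_eq_C_mul]
        exact Submodule.smul_mem _ _ (pderiv_mem_harmonicSpace horth i k)
    · have h1 := hrel k
      simp_rw [← hκ, hexp T _ (hκT _)] at h1
      rw [hexp T ρ Finset.subset_union_left, ← sub_eq_zero, Finset.sum_mul] at h1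
      simp_rw [Finset.sum_mul] at h1
      rw [Finset.sum_comm, ← Finset.sum_sub_distrib] at h1
      rw [← h1]
      refine Finset.sum_congr rfl fun a _ => ?_
      rw [mul_sub, Finset.mul_sum]
      refine congr (congrArg HSub.hSub ?_) ?_
      · ring
      · exact Finset.sum_congr rfl fun i _ => by ring
  have hne := mem_support_iff.mp ha₀
  refine ⟨fun i => (coeff a₀ ρ)⁻¹ * coeff a₀ (κ i), fun k => ?_⟩
  have h1 := congrArg (C (coeff a₀ ρ)⁻¹ * ·) (sub_eq_zero.mp (hcoef k))
  simp only [← mul_assoc, ← C_mul, inv_mul_cancel₀ hne, C_1, one_mul, Finset.mul_sum] at h1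
  rw [h1]
  exact Finset.sum_congr rfl fun i _ => by rw [smul_eq_C_mul]

end Gradients

/-! ### Elements of `S ⊗ V^*` in coordinates -/

section Forms

variable {V : Type*} [NormedAddCommGroup V] [InnerProductSpace ℂ V] {n : ℕ}
  (b : OrthonormalBasis (Fin n) ℂ V) {W : Subgroup (V ≃ₗᵢ[ℂ] V)}

/-- The coefficient of `x_k` of an element of `S ⊗ V^*`. -/
def formCoeff (k : Fin n) :
    MvPolynomial (Fin n) ℂ ⊗[ℂ] Module.Dual ℂ V →ₗ[ℂ] MvPolynomial (Fin n) ℂ :=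
  (TensorProduct.rid ℂ (MvPolynomial (Fin n) ℂ)).toLinearMap ∘ₗ
    (Module.Dual.eval ℂ V (b k)).lTensor (MvPolynomial (Fin n) ℂ)

theorem formCoeff_tmul (k : Fin n) (p : MvPolynomial (Fin n) ℂ) (M : Module.Dual ℂ V) :
    formCoeff b k (p ⊗ₜ M) = M (b k) • p := by
  simp [formCoeff]

theorem coord_apply_basis [DecidableEq (Fin n)] (j k : Fin n) :
    b.toBasis.coord j (b k) = if k = j then 1 else 0 := by
  rw [← b.coe_toBasis, Module.Basis.coord_apply, Module.Basis.repr_self, Finsupp.single_apply]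

theorem sum_formCoeff_tmul (ω : MvPolynomial (Fin n) ℂ ⊗[ℂ] Module.Dual ℂ V) :
    ∑ j, formCoeff b j ω ⊗ₜ b.toBasis.coord j = ω := by
  induction ω with
  | zero => simp
  | add x y hx hy => simp_rw [map_add, TensorProduct.add_tmul, Finset.sum_add_distrib, hx, hy]
  | tmul p M =>
    simp_rw [formCoeff_tmul, TensorProduct.smul_tmul]
    rw [← TensorProduct.tmul_sum]
    congr 1
    refine b.toBasis.ext fun k => ?_
    classical
    simp

theorem ext_formCoeff {ω η : MvPolynomial (Fin n) ℂ ⊗[ℂ] Module.Dual ℂ V}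
    (h : ∀ k, formCoeff b k ω = formCoeff b k η) : ω = η := by
  rw [← sum_formCoeff_tmul b ω, ← sum_formCoeff_tmul b η]
  simp_rw [h]

theorem formCoeff_sum_tmul (g : Fin n → MvPolynomial (Fin n) ℂ) (k : Fin n) :
    formCoeff b k (∑ j, g j ⊗ₜ b.toBasis.coord j) = g k := by
  classical
  simp_rw [map_sum, formCoeff_tmul, coord_apply_basis]
  simp

theorem differential_apply (p : MvPolynomial (Fin n) ℂ) :
    differential b p = ∑ j, pderiv j p ⊗ₜ b.toBasis.coord j := by
  simp [differential, LinearMap.sum_apply]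

theorem formCoeff_differential (k : Fin n) (p : MvPolynomial (Fin n) ℂ) :
    formCoeff b k (differential b p) = pderiv k p := by
  rw [differential_apply, formCoeff_sum_tmul]

theorem formCoeff_formAct (w : V ≃ₗᵢ[ℂ] V) (k : Fin n)
    (ω : MvPolynomial (Fin n) ℂ ⊗[ℂ] Module.Dual ℂ V) :
    formCoeff b k (formAct b w ω) =
      ∑ j, C (dualAct w (b.toBasis.coord j) (b k)) * polyAct b w (formCoeff b j ω) := by
  conv_lhs => rw [← sum_formCoeff_tmul b ω]
  rw [map_sum, map_sum]
  refine Finset.sum_congr rfl fun j _ => ?_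
  rw [formAct, TensorProduct.map_tmul, formCoeff_tmul, smul_eq_C_mul]
  rfl

theorem mem_range_rTensor_iff (M : Submodule ℂ (MvPolynomial (Fin n) ℂ))
    (ω : MvPolynomial (Fin n) ℂ ⊗[ℂ] Module.Dual ℂ V) :
    ω ∈ LinearMap.range (M.subtype.rTensor (Module.Dual ℂ V)) ↔ ∀ k, formCoeff b k ω ∈ M := by
  constructor
  · rintro ⟨η, rfl⟩ k
    induction η with
    | zero => rw [map_zero, map_zero]; exact zero_mem _
    | add x y hx hy => rw [map_add, map_add]; exact add_mem hx hy
    | tmul p N =>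
      rw [LinearMap.rTensor_tmul, formCoeff_tmul]
      exact Submodule.smul_mem _ _ p.2
  · intro h
    refine ⟨∑ j, (⟨formCoeff b j ω, h j⟩ : M) ⊗ₜ b.toBasis.coord j, ?_⟩
    rw [map_sum]
    exact sum_formCoeff_tmul b ω

theorem mem_invariantForms_iff (M : Submodule ℂ (MvPolynomial (Fin n) ℂ))
    (ω : MvPolynomial (Fin n) ℂ ⊗[ℂ] Module.Dual ℂ V) :
    ω ∈ invariantForms b W M ↔
      (∀ k, formCoeff b k ω ∈ M) ∧ IsInvariantTuple b W fun k => formCoeff b k ω := by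
  rw [invariantForms, Submodule.mem_inf, mem_range_rTensor_iff b]
  refine and_congr Iff.rfl ?_
  simp only [Submodule.mem_iInf, LinearMap.mem_eqLocus, LinearMap.id_apply]
  refine forall₂_congr fun w _ => ⟨fun h k => ?_, fun h => ext_formCoeff b fun k => ?_⟩
  · rw [← formCoeff_formAct, h]
  · rw [formCoeff_formAct, h]

theorem epsilon_differential (p : MvPolynomial (Fin n) ℂ) :
    epsilon b (differential b p) = ∑ j, X j * pderiv j p := by
  rw [differential_apply, map_sum]
  refine Finset.sum_congr rfl fun j _ => ?_
  rw [epsilon, TensorProduct.lift.tmul, LinearMap.compl₂_apply, linForm_coord, mul_comm]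
  rfl

end Forms
/-! ### Canonical systems -/

section Canonical

variable {V : Type*} [NormedAddCommGroup V] [InnerProductSpace ℂ V] {n : ℕ}
  (b : OrthonormalBasis (Fin n) ℂ V) {W : Subgroup (V ≃ₗᵢ[ℂ] V)}
  {f : Fin n → MvPolynomial (Fin n) ℂ}

theorem exists_pos_degree (hf : IsBasicInvariants b W f) (i : Fin n) :
    ∃ m : ℕ, 0 < m ∧ (f i).IsHomogeneous m := by
  obtain ⟨m, hm⟩ := hf.homogeneous i
  refine ⟨m, Nat.pos_of_ne_zero fun h0 => ?_, hm⟩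
  subst h0
  have h1 : f i = C (coeff 0 (f i)) := totalDegree_eq_zero_iff_eq_C.mp
    (Nat.le_zero.mp hm.totalDegree_le)
  have h2 : (X i : MvPolynomial (Fin n) ℂ) = C (coeff 0 (f i)) := by
    refine hf.algebraicIndependent ?_
    rw [aeval_X, aeval_C, algebraMap_eq]
    exact h1
  have h3 := congrArg totalDegree h2
  rw [totalDegree_X, totalDegree_C] at h3
  exact one_ne_zero h3

theorem constantCoeff_eq_zero_of_isHomogeneous {p : MvPolynomial (Fin n) ℂ} {m : ℕ}
    (hp : p.IsHomogeneous m) (hm : 0 < m) : constantCoeff p = 0 := by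
  rw [constantCoeff_eq]
  exact hp.coeff_eq_zero (by rw [map_zero]; exact hm.ne)

/-- The operator of an invariant maps each member of a canonical system to a linear combination of
itself and `1`. -/
theorem exists_starOp_eq_smul_add_C (hf : IsCanonicalSystem b W f)
    (hf0 : ∀ i, constantCoeff (f i) = 0) (j : Fin n) {r : MvPolynomial (Fin n) ℂ}
    (hr : r ∈ invariants b W) :
    ∃ c : ℂ, starOp r (f j) = (starRingEnd ℂ) (constantCoeff r) • f j + C c := by
  have hconst : ∀ (p : MvPolynomial (Fin n) ℂ) (c : ℂ), ∃ c', starOp p (C c) = C c' := by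
    intro p c
    refine ⟨_, totalDegree_eq_zero_iff_eq_C.mp (Nat.le_zero.mp ?_)⟩
    exact (totalDegree_starOp_le p (C c)).trans (totalDegree_C c).le
  rw [← hf.basic.generate] at hr
  induction hr using Algebra.adjoin_induction with
  | mem x hx =>
    obtain ⟨i, rfl⟩ := hx
    rw [hf.orthonormal, hf0, map_zero]
    refine ⟨if i = j then 1 else 0, ?_⟩
    split_ifs <;> simp
  | algebraMap c =>
    refine ⟨0, ?_⟩
    rw [algebraMap_eq, starOp_C, constantCoeff_C, C_0, add_zero]
    rfl
  | add p q _ _ hp hq =>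
    obtain ⟨c, hc⟩ := hp
    obtain ⟨c', hc'⟩ := hq
    refine ⟨c + c', ?_⟩
    rw [starOp_add, LinearMap.add_apply, hc, hc', map_add, map_add, add_smul, C_add]
    abel
  | mul p q _ _ hp hq =>
    obtain ⟨c, hc⟩ := hp
    obtain ⟨c', hc'⟩ := hq
    obtain ⟨c'', hc''⟩ := hconst p c'
    refine ⟨(starRingEnd ℂ) (constantCoeff q) * c + c'', ?_⟩
    rw [starOp_mul, Module.End.mul_apply, hc', map_add, map_smul, hc, hc'', map_mul, map_mul,
      smul_add, smul_smul, C_add, C_mul, ← smul_eq_C_mul, mul_comm]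
    exact add_assoc _ _ _

theorem mem_annihilatedInvariants {k : ℕ} {p : MvPolynomial (Fin n) ℂ} :
    p ∈ annihilatedInvariants b W k ↔ (p ∈ invariants b W ∧ p.IsHomogeneous k) ∧
      ∀ l : ℕ, 0 < l → l < k → ∀ g ∈ invariants b W, g.IsHomogeneous l → starOp g p = 0 := by
  constructor
  · exact fun h => ⟨h.1, fun l h0 hl g hg hg' => h.2 l h0 hl g ⟨hg, hg'⟩⟩
  · exact fun h => ⟨h.1, fun l h0 hl g hg => h.2 l h0 hl g hg.1 hg.2⟩

theorem mem_annihilatedInvariants_of_isHomogeneous (hf : IsCanonicalSystem b W f)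
    (hf0 : ∀ i, constantCoeff (f i) = 0) {j : Fin n} {m : ℕ} (hm : (f j).IsHomogeneous m) :
    f j ∈ annihilatedInvariants b W m := by
  refine (mem_annihilatedInvariants b).mpr
    ⟨⟨mem_invariants_of_generate b hf.basic.generate j, hm⟩, fun l h0 hl g hg hgl => ?_⟩
  obtain ⟨c, hc⟩ := exists_starOp_eq_smul_add_C b hf hf0 j hg
  rw [constantCoeff_eq_zero_of_isHomogeneous hgl h0, map_zero, zero_smul, zero_add] at hc
  by_contra hne
  have h1 : coeff 0 (starOp g (f j)) ≠ 0 := by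
    rw [hc, coeff_zero_C]
    rintro rfl
    exact hne (by rw [hc, C_0])
  have h2 := degree_add_eq_of_coeff_starOp_ne_zero hgl hm h1
  rw [map_zero] at h2
  lia

/-- Subtracting from `p` its orthogonal projection to the span of the `f i` yields an invariant
without constant term that is annihilated by all `(f i)^*`, hence zero. -/
theorem mem_span_of_mem_annihilatedInvariants (hf : IsCanonicalSystem b W f)
    (hf0 : ∀ i, constantCoeff (f i) = 0) {k : ℕ} (hk : 0 < k) {p : MvPolynomial (Fin n) ℂ}
    (hp : p ∈ annihilatedInvariants b W k) : p ∈ Submodule.span ℂ (Set.range f) := by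
  classical
  obtain ⟨⟨hpR, hpk⟩, hann⟩ := (mem_annihilatedInvariants b).mp hp
  have hinv := mem_invariants_of_generate b hf.basic.generate
  have hconst : ∀ i, starOp (f i) p = C (coeff 0 (starOp (f i) p)) := by
    intro i
    obtain ⟨m, hm0, hm⟩ := exists_pos_degree b hf.basic i
    by_cases hmk : m < k
    · rw [hann m hm0 hmk _ (hinv i) hm, coeff_zero, C_0]
    · ext a
      rw [coeff_C]
      split_ifs with h0
      · rw [h0]
      · by_contra hne
        have h2 := degree_add_eq_of_coeff_starOp_ne_zero hm hpk hne
        exact h0 ((Finsupp.degree_eq_zero_iff a).mp (by lia)).symm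
  have hsum : ∑ i, coeff 0 (starOp (f i) p) • f i ∈ Submodule.span ℂ (Set.range f) :=
    sum_mem fun i _ => Submodule.smul_mem _ _ (Submodule.subset_span ⟨i, rfl⟩)
  have hharm : p - ∑ i, coeff 0 (starOp (f i) p) • f i ∈ harmonicSpace f := by
    refine mem_harmonicSpace.mpr fun j => ?_
    rw [map_sub, map_sum, Finset.sum_eq_single j, map_smul, hf.orthonormal, if_pos rfl,
      smul_eq_C_mul, mul_one, ← hconst, sub_self]
    · intro i _ hi
      rw [map_smul, hf.orthonormal, if_neg hi.symm, smul_zero]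
    · simp
  have hI : p - ∑ i, coeff 0 (starOp (f i) p) • f i ∈ Ideal.span (Set.range f) := by
    refine sub_mem ?_ (sum_mem fun i _ => ?_)
    · have h1 := sub_constantCoeff_mem b hf.basic.generate hf0 hpR
      rwa [constantCoeff_eq_zero_of_isHomogeneous hpk hk, C_0, sub_zero] at h1
    · rw [smul_eq_C_mul]
      exact Ideal.mul_mem_left _ _ (Ideal.subset_span ⟨i, rfl⟩)
  rw [sub_eq_zero.mp (eq_zero_of_mem_ideal_of_mem_harmonicSpace hI hharm)]
  exact hsum

theorem span_eq_iSup_annihilatedInvariants (hf : IsCanonicalSystem b W f)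
    (hf0 : ∀ i, constantCoeff (f i) = 0) :
    Submodule.span ℂ (Set.range f) = ⨆ k : ℕ+, annihilatedInvariants b W k := by
  refine le_antisymm (Submodule.span_le.mpr ?_) (iSup_le fun k p hp =>
    mem_span_of_mem_annihilatedInvariants b hf hf0 k.pos hp)
  rintro _ ⟨j, rfl⟩
  obtain ⟨m, hm0, hm⟩ := exists_pos_degree b hf.basic j
  exact le_iSup (fun k : ℕ+ => annihilatedInvariants b W k) ⟨m, hm0⟩
    (mem_annihilatedInvariants_of_isHomogeneous b hf hf0 hm)

theorem iSupIndep_annihilatedInvariants :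
    iSupIndep fun k : ℕ+ => annihilatedInvariants b W k := by
  let : DirectSum.Decomposition (homogeneousSubmodule (Fin n) ℂ) := decomposition
  have h1 : iSupIndep (homogeneousSubmodule (Fin n) ℂ) :=
    (DirectSum.Decomposition.isInternal (homogeneousSubmodule (Fin n) ℂ)).submodule_iSupIndep
  exact (h1.comp PNat.coe_injective).mono fun k p hp => ((mem_annihilatedInvariants b).mp hp).1.2

theorem span_differential_eq_invariantForms {L : Submodule ℂ V → Module.Dual ℂ V}
    (hW : IsFiniteReflectionGroup W)
    (hL : ∀ H ∈ reflectingHyperplanes W, LinearMap.ker (L H) = H)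
    (hf : IsCanonicalSystem b W f) (hf0 : ∀ i, constantCoeff (f i) = 0) :
    Submodule.span ℂ (Set.range fun i => differential b (f i)) =
      invariantForms b W (harmonics b W L) := by
  have hgen := hf.basic.generate
  rw [harmonics_eq_harmonicSpace b hW hL hgen hf0]
  refine le_antisymm (Submodule.span_le.mpr ?_) fun ω hω => ?_
  · rintro _ ⟨i, rfl⟩
    refine (mem_invariantForms_iff b _ _).mpr ?_
    simp only [formCoeff_differential]
    exact ⟨fun k => pderiv_mem_harmonicSpace hf.orthonormal i k,
      isInvariantTuple_pderiv b (mem_invariants_of_generate b hgen i)⟩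
  · obtain ⟨hharm, hinv⟩ := (mem_invariantForms_iff b _ _).mp hω
    obtain ⟨c, hc⟩ := exists_eq_sum_smul_gradient b hW hL hgen hf0
      hf.basic.algebraicIndependent hf.orthonormal hinv hharm
    have h1 : ω = ∑ i, c i • differential b (f i) := ext_formCoeff b fun k => by
      simp_rw [map_sum, map_smul, formCoeff_differential]
      exact hc k
    rw [h1]
    exact sum_mem fun i _ => Submodule.smul_mem _ _ (Submodule.subset_span ⟨i, rfl⟩)

theorem map_epsilon_span_differential (hf : IsBasicInvariants b W f) :
    (Submodule.span ℂ (Set.range fun i => differential b (f i))).map (epsilon b) =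
      Submodule.span ℂ (Set.range f) := by
  have hE : ∀ i, ∃ m : ℕ, 0 < m ∧ epsilon b (differential b (f i)) = (m : ℂ) • f i := fun i => by
    obtain ⟨m, hm0, hm⟩ := exists_pos_degree b hf i
    exact ⟨m, hm0, by rw [epsilon_differential, hm.sum_X_mul_pderiv, Nat.cast_smul_eq_nsmul]⟩
  rw [Submodule.map_span]
  refine le_antisymm (Submodule.span_le.mpr ?_) (Submodule.span_le.mpr ?_)
  · rintro _ ⟨_, ⟨i, rfl⟩, rfl⟩
    obtain ⟨m, -, h⟩ := hE i
    exact h ▸ Submodule.smul_mem _ _ (Submodule.subset_span ⟨i, rfl⟩)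
  · rintro _ ⟨i, rfl⟩
    obtain ⟨m, hm0, h⟩ := hE i
    have h1 : f i = (m : ℂ)⁻¹ • epsilon b (differential b (f i)) := by
      rw [h, smul_smul, inv_mul_cancel₀ (by exact_mod_cast hm0.ne'), one_smul]
    rw [h1]
    exact Submodule.smul_mem _ _ (Submodule.subset_span ⟨_, ⟨i, rfl⟩, rfl⟩)

end Canonical
end UnitaryReflection

end

theorem mainTheorem2 {V : Type*} [NormedAddCommGroup V] [InnerProductSpace ℂ V] {n : ℕ}
    (b : OrthonormalBasis (Fin n) ℂ V) (W : Subgroup (V ≃ₗᵢ[ℂ] V))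
    (hW : UnitaryReflection.IsFiniteReflectionGroup W)
    (hirr : (UnitaryReflection.tautologicalRep W).IsIrreducible)
    (L : Submodule ℂ V → Module.Dual ℂ V)
    (hL : ∀ H ∈ UnitaryReflection.reflectingHyperplanes W, LinearMap.ker (L H) = H)
    (f : Fin n → MvPolynomial (Fin n) ℂ)
    (hf : UnitaryReflection.IsCanonicalSystem b W f) :
    (iSupIndep (fun k : ℕ+ => UnitaryReflection.annihilatedInvariants b W k) ∧
      Submodule.span ℂ (Set.range f) =
        ⨆ k : ℕ+, UnitaryReflection.annihilatedInvariants b W k) ∧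
    Submodule.span ℂ (Set.range fun i => UnitaryReflection.differential b (f i)) =
      UnitaryReflection.invariantForms b W (UnitaryReflection.harmonics b W L) ∧
    Submodule.span ℂ (Set.range f) =
      (UnitaryReflection.invariantForms b W (UnitaryReflection.harmonics b W L)).map
        (UnitaryReflection.epsilon b) := by
  have hf0 : ∀ i, constantCoeff (f i) = 0 := fun i => by
    obtain ⟨m, hm0, hm⟩ := UnitaryReflection.exists_pos_degree b hf.basic i
    exact UnitaryReflection.constantCoeff_eq_zero_of_isHomogeneous hm hm0
  have h2 := UnitaryReflection.span_differential_eq_invariantForms b hW hL hf hf0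
  refine ⟨⟨UnitaryReflection.iSupIndep_annihilatedInvariants b,
    UnitaryReflection.span_eq_iSup_annihilatedInvariants b hf hf0⟩, h2, ?_⟩
  rw [← h2, UnitaryReflection.map_epsilon_span_differential b hf.basic]
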